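/- Let $n\ge 0$, let $\lambda=(\lambda_1\ge\lambda_2\ge\cdots\ge\lambda_n\ge 0)$ be a partition with at most $n$ nonzero parts, and let $\mu=\lambda+\delta$ with $\delta=(n,n-1,\dots,1)$, so that $\mu_i=\lambda_i+n-i+1$. Let $x_1,\dots,x_n$ be nonzero elements of a field $K$ and let $t\in K$ (for instance, independent indeterminates). Use the alphabet $\overline 1<1<\overline 2<2<\cdots<\overline n<n$. A semistandard symplectic tableau $T\in\mathcal T^{\lambda}(n,\overline n)$ is a filling of the Young diagram of $\lambda$ with letters of this alphabet, weakly increasing along rows from left to right and strictly increasing down columns, in which $k$ and $\overline k$ appear no lower than row $k$. A semistandard shifted symplectic tableau $ST\in\mathcal{ST}^{\mu}(n,\overline n)$ is a filling of the shifted Young diagram of $\mu$ (row $i$ has $\mu_i$ boxes, in columns $i,\dots,i+\mu_i-1$) with letters of this alphabet, weakly increasing along rows from left to right and down columns, strictly increasing down each diagonal from top-left to bottom-right, and whose $k$-th main-diagonal entry is $k$ or $\overline k$ for $k=1,\dots,n$. For either kind of tableau, $\mathrm{wgt}=(w_1,\dots,w_n)$, where $w_k$ is the number of entries $k$ minus the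 number of entries $\overline k$; $\mathbf x^{\mathrm{wgt}}=\prod_{k} x_k^{w_k}$; and $\mathrm{bar}$ is the number of barred entries. For $ST$ and a letter $a$, let $\mathrm{row}_a$ and $\mathrm{col}_a$ be the numbers of rows and of columns containing an entry $a$, and let $\mathrm{con}_a$ be the number of connected components (boxes being adjacent when they share an edge) of the set of boxes with entry $a$. Put $$\mathrm{str}=\sum_{k=1}^n(\mathrm{con}_k+\mathrm{con}_{\overline k}),\qquad \mathrm{var}=\sum_{k=1}^n\left(\mathrm{row}_k-\mathrm{con}_k+\mathrm{col}_{\overline k}-\mathrm{con}_{\overline k}\right).$$ Let $sp_\lambda(\mathbf x;t)=\sum_{T\in\mathcal T^{\lambda}(n,\overline n)}t^{2\,\mathrm{bar}(T)}\,\mathbf x^{\mathrm{wgt}(T)}$. Then $$\prod_{i=1}^n(x_i+t x_i^{-1})\prod_{1\le i<j\le n}(x_i+t^2x_i^{-1}+t x_j+t x_j^{-1})\;sp_\lambda(\mathbf x;t)=\sum_{ST\in\mathcal{ST}^{\mu}(n,\overline n)}t^{\mathrm{var}(ST)+\mathrm{bar}(ST)}(1+t)^{\mathrm{str}(ST)-n}\,\mathbf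 x^{\mathrm{wgt}(ST)} .$$ -/

import Mathlib

namespace SpTableaux

/-- The alphabet `{1̄, 1, 2̄, 2, …, n̄, n}` with the total order `1̄ < 1 < 2̄ < 2 < ⋯ < n̄ < n`
(lexicographic order, with `false < true`); the index `k : Fin n` stands for the number `k + 1`. -/
abbrev Letter (n : ℕ) : Type := Fin n ×ₗ Bool

/-- The barred letter `k̄`. -/
def barred {n : ℕ} (k : Fin n) : Letter n := toLex (k, false)

/-- The unbarred letter `k`. -/
def unbarred {n : ℕ} (k : Fin n) : Letter n := toLex (k, true)

/-- The number `k` underlying a letter `k` or `k̄` (zero-based). -/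
def Letter.index {n : ℕ} (a : Letter n) : Fin n := (ofLex a).1

/-- A numbering of the boxes of the diagram `D` with entries from `{1̄, 1, …, n̄, n}`.
The box in row `i` and column `j` is `(i, j)`, counted from `0`, rows from top to bottom. -/
abbrev Filling (n : ℕ) (D : Finset (ℕ × ℕ)) : Type := {c : ℕ × ℕ // c ∈ D} → Letter n

section statistics

variable {n : ℕ} {D : Finset (ℕ × ℕ)}

/-- The boxes of the filling whose entry is `a`. -/
def boxes (T : Filling n D) (a : Letter n) : Finset {c : ℕ × ℕ // c ∈ D} :=
  Finset.univ.filter (fun c => T c = a)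

/-- The number of times `a` appears. -/
def count (T : Filling n D) (a : Letter n) : ℕ := (boxes T a).card

/-- The `k`-th component `n_k - n_{k̄}` of the weight. -/
def wgt (T : Filling n D) (k : Fin n) : ℤ :=
  (count T (unbarred k) : ℤ) - (count T (barred k) : ℤ)

/-- The total number of barred entries. -/
def bar (T : Filling n D) : ℕ := ∑ k : Fin n, count T (barred k)

/-- The number of rows containing the entry `a`. -/
def row (T : Filling n D) (a : Letter n) : ℕ := ((boxes T a).image (fun c => c.1.1)).card

/-- The number of columns containing the entry `a`. -/
def col (T : Filling n D) (a : Letter n) : ℕ := ((boxes T a).image (fun c => c.1.2)).card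

end statistics

/-- Two boxes are adjacent when they share an edge. -/
def boxGraph : SimpleGraph (ℕ × ℕ) where
  Adj c d := (c.1 = d.1 ∧ (c.2 + 1 = d.2 ∨ d.2 + 1 = c.2)) ∨
    (c.2 = d.2 ∧ (c.1 + 1 = d.1 ∨ d.1 + 1 = c.1))
  symm := ⟨by
    rintro c d (⟨h, h'⟩ | ⟨h, h'⟩)
    · exact Or.inl ⟨h.symm, h'.symm⟩
    · exact Or.inr ⟨h.symm, h'.symm⟩⟩
  loopless := ⟨by
    intro c h
    omega⟩

section ribbons

variable {n : ℕ} {D : Finset (ℕ × ℕ)}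

/-- The number of connected components of the part of the diagram filled with the entry `a`. -/
noncomputable def con (T : Filling n D) (a : Letter n) : ℕ :=
  Nat.card (boxGraph.induce {c : ℕ × ℕ | ∃ h : c ∈ D, T ⟨c, h⟩ = a}).ConnectedComponent

/-- The total number of connected components of all the ribbon strips. -/
noncomputable def str (T : Filling n D) : ℕ := ∑ a : Letter n, con T a

/-- `var = ∑ₖ (rowₖ - conₖ + col_{k̄} - con_{k̄})`. -/
noncomputable def var (T : Filling n D) : ℤ :=
  ∑ k : Fin n, ((row T (unbarred k) : ℤ) - (con T (unbarred k) : ℤ) +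
    (col T (barred k) : ℤ) - (con T (barred k) : ℤ))

end ribbons

/-- Semistandard symplectic tableaux of shape `lam`. -/
structure IsSymplectic {n : ℕ} {lam : YoungDiagram} (T : Filling n lam.cells) : Prop where
  row_weak : ∀ c d : {c : ℕ × ℕ // c ∈ lam.cells}, c.1.1 = d.1.1 → c.1.2 ≤ d.1.2 → T c ≤ T d
  col_strict : ∀ c d : {c : ℕ × ℕ // c ∈ lam.cells}, c.1.2 = d.1.2 → c.1.1 < d.1.1 → T c < T d
  /-- `k` and `k̄` appear no lower than the `k`-th row. -/
  row_le : ∀ c : {c : ℕ × ℕ // c ∈ lam.cells}, c.1.1 ≤ ((T c).index : ℕ)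

open Classical in
/-- The set of semistandard symplectic tableaux of shape `lam`. -/
noncomputable def symplecticTableaux (n : ℕ) (lam : YoungDiagram) :
    Finset (Filling n lam.cells) :=
  Finset.univ.filter IsSymplectic

/-- The `t`-deformed symplectic character `∑_T t^{2 bar(T)} x^{wgt(T)}`. -/
noncomputable def spChar {K : Type*} [Field K] {n : ℕ} (lam : YoungDiagram) (x : Fin n → K)
    (t : K) : K :=
  ∑ T ∈ symplecticTableaux n lam, t ^ (2 * bar T) * ∏ k : Fin n, x k ^ wgt T k

/-- The `n` parts of `lam + δ`, where `δ = (n, n - 1, …, 1)`. -/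
def addStaircase (n : ℕ) (lam : YoungDiagram) (i : Fin n) : ℕ := lam.rowLen i + (n - i)

/-- The shifted diagram with rows of lengths `μ 0, μ 1, …, μ (n - 1)`, row `i` starting in
column `i`. -/
def shiftedCells {n : ℕ} (μ : Fin n → ℕ) : Finset (ℕ × ℕ) :=
  Finset.univ.biUnion fun i : Fin n =>
    (Finset.range (μ i)).image fun j : ℕ => ((i : ℕ), (i : ℕ) + j)

/-- Semistandard shifted symplectic tableaux of shape `μ`. -/
structure IsShiftedSymplectic {n : ℕ} {μ : Fin n → ℕ} (S : Filling n (shiftedCells μ)) :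
    Prop where
  row_weak : ∀ c d : {c : ℕ × ℕ // c ∈ shiftedCells μ},
    c.1.1 = d.1.1 → c.1.2 ≤ d.1.2 → S c ≤ S d
  col_weak : ∀ c d : {c : ℕ × ℕ // c ∈ shiftedCells μ},
    c.1.2 = d.1.2 → c.1.1 ≤ d.1.1 → S c ≤ S d
  /-- Strict increase down each diagonal, from top-left to bottom-right. -/
  diag_strict : ∀ (c d : {c : ℕ × ℕ // c ∈ shiftedCells μ}) (m : ℕ), 0 < m →
    d.1.1 = c.1.1 + m → d.1.2 = c.1.2 + m → S c < S d
  /-- The `k`-th entry on the main diagonal is `k` or `k̄`. -/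
  main_diag : ∀ c : {c : ℕ × ℕ // c ∈ shiftedCells μ}, c.1.1 = c.1.2 →
    ((S c).index : ℕ) = c.1.1

open Classical in
/-- The set of semistandard shifted symplectic tableaux of shape `μ`. -/
noncomputable def shiftedSymplecticTableaux {n : ℕ} (μ : Fin n → ℕ) :
    Finset (Filling n (shiftedCells μ)) :=
  Finset.univ.filter IsShiftedSymplectic

end SpTableaux

/-! Both sides reduce to the same determinant. Number variables from zero and put
$C_{k,j}(w)=\prod_{j\le i<k}\frac{w}{(1-x_iw)(1-t^2x_i^{-1}w)}$ (`column`). Then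
$sp_\lambda=\det\bigl([w^{\mu_i}]C_{n,j}\bigr)$ (`fillSum_symplectic`), and the sum over shifted
tableaux is the deformed Weyl denominator times this determinant (`fillSum_shifted`).

Each formula is an induction on $k$ that removes the letters $k$ and $\overline k$ one at a time.
Removing the largest letter leaves a shape interlacing with the given one (`fillSum_insert`,
`sum_isStrip`), and the weight of the removed strip is a product over rows. By multilinearity the
sum over interlacing shapes is one determinant, whose row $i$ is a sum over the interval
$[\nu_{i+1},\nu_i]$. Subtracting multiples of consecutive rows extends the interval to $[0,\nu_i]$
(`sum_stripWeight`, `det_stripWeight`). The entries are then convolutions: up to a boundary term,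
each column series is multiplied by $(1+yw)/(1-zw)$, with $y=0$ in the symplectic case.

In the shifted case the numerators for $k$ and $\overline k$ multiply to $(1+tx_kw)(1+tx_k^{-1}w)$.
This differs from $(1-x_jw)(1-t^2x_j^{-1}w)$ only in the linear term, and the difference of the
linear coefficients is the denominator factor for $(j,k)$. Hence each stage multiplies the matrix by
a lower bidiagonal one (`ratio_mul_ratio_mul_column`, `det_stripSum_column`). The rule for the main
diagonal produces its last entry $x_k+tx_k^{-1}$. -/

namespace SpTableaux

/-! ### Generating functions of fillings and removal of the largest letter. -/

/-- A numbering of `D` subject to weak inequalities along `R₁`, strict inequalities along `R₂`, and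
a condition `Q` on the entry of each box. -/
structure IsValid {n : ℕ} (R₁ R₂ : ℕ × ℕ → ℕ × ℕ → Prop) (Q : ℕ × ℕ → Letter n → Prop)
    {D : Finset (ℕ × ℕ)} (T : Filling n D) : Prop where
  weak : ∀ c d : {c : ℕ × ℕ // c ∈ D}, R₁ c.1 d.1 → T c ≤ T d
  strict : ∀ c d : {c : ℕ × ℕ // c ∈ D}, R₂ c.1 d.1 → T c < T d
  entry : ∀ c : {c : ℕ × ℕ // c ∈ D}, Q c.1 (T c)

/-- The boxes of `D` outside `E` can receive a letter `b` exceeding all letters in `E`. -/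
structure IsStrip {n : ℕ} (R₁ R₂ : ℕ × ℕ → ℕ × ℕ → Prop) (Q : ℕ × ℕ → Letter n → Prop)
    (b : Letter n) (D E : Finset (ℕ × ℕ)) : Prop where
  weak : ∀ c ∈ D, ∀ d ∈ E, R₁ c d → c ∈ E
  strict : ∀ c ∈ D, ∀ d ∈ D, R₂ c d → c ∈ E
  entry : ∀ c ∈ D, c ∉ E → Q c b

/-- The boxes with entry `a`, as a set of boxes of the plane. -/
def cellsOf {n : ℕ} {D : Finset (ℕ × ℕ)} (T : Filling n D) (a : Letter n) : Finset (ℕ × ℕ) :=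
  (boxes T a).map (Function.Embedding.subtype _)

theorem mem_cellsOf {n : ℕ} {D : Finset (ℕ × ℕ)} {T : Filling n D} {a : Letter n} {c : ℕ × ℕ} :
    c ∈ cellsOf T a ↔ ∃ h : c ∈ D, T ⟨c, h⟩ = a := by
  simp [cellsOf, boxes]

open Classical in
/-- The generating function of the valid fillings of `D` with letters from `A`, where the boxes
with entry `a` contribute the weight `g a`. -/
noncomputable def fillSum {K : Type*} [CommRing K] {n : ℕ} (R₁ R₂ : ℕ × ℕ → ℕ × ℕ → Prop)
    (Q : ℕ × ℕ → Letter n → Prop) (g : Letter n → Finset (ℕ × ℕ) → K) (A : Finset (Letter n))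
    (D : Finset (ℕ × ℕ)) : K :=
  ∑ T : Filling n D with IsValid R₁ R₂ Q T ∧ ∀ c, T c ∈ A, ∏ a ∈ A, g a (cellsOf T a)

section fillSum

variable {K : Type*} [CommRing K] {n : ℕ} {R₁ R₂ : ℕ × ℕ → ℕ × ℕ → Prop}
  {Q : ℕ × ℕ → Letter n → Prop} {g : Letter n → Finset (ℕ × ℕ) → K} {A : Finset (Letter n)}

theorem fillSum_empty_empty : fillSum R₁ R₂ Q g ∅ ∅ = 1 := by
  classical
  have h : (Finset.univ.filter fun T : Filling n ∅ => IsValid R₁ R₂ Q T ∧ ∀ c, T c ∈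
      (∅ : Finset (Letter n))) = Finset.univ := by
    apply Finset.filter_true_of_mem
    intro T _
    exact ⟨⟨fun c => absurd c.2 (Finset.notMem_empty _), fun c => absurd c.2 (Finset.notMem_empty _),
      fun c => absurd c.2 (Finset.notMem_empty _)⟩, fun c => absurd c.2 (Finset.notMem_empty _)⟩
  rw [fillSum, h]
  simp

theorem fillSum_eq_zero {D : Finset (ℕ × ℕ)} {c : ℕ × ℕ} (hc : c ∈ D) (h : ∀ a ∈ A, ¬ Q c a) :
    fillSum R₁ R₂ Q g A D = 0 := by
  classical
  rw [fillSum, Finset.filter_false_of_mem, Finset.sum_empty]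
  rintro T - ⟨hT, hA⟩
  exact h _ (hA ⟨c, hc⟩) (hT.entry ⟨c, hc⟩)

open Classical in
/-- Splitting off the largest letter. -/
theorem fillSum_insert {b : Letter n} (hb : ∀ a ∈ A, a < b) (D : Finset (ℕ × ℕ)) :
    fillSum R₁ R₂ Q g (insert b A) D =
      ∑ E ∈ D.powerset with IsStrip R₁ R₂ Q b D E, g b (D \ E) * fillSum R₁ R₂ Q g A E := by
  have hbA : b ∉ A := fun h => (hb b h).false
  obtain ⟨inner, mem_inner⟩ : ∃ inner : Filling n D → Finset (ℕ × ℕ),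
      ∀ T c, c ∈ inner T ↔ ∃ h : c ∈ D, T ⟨c, h⟩ ∈ A := by
    refine ⟨fun T => D.filter fun c => ∃ h : c ∈ D, T ⟨c, h⟩ ∈ A, fun T c => ?_⟩
    simp only [Finset.mem_filter, and_iff_right_iff_imp]
    exact fun h => h.1
  -- Fillings are grouped by the subdiagram occupied by the letters other than `b`.
  rw [fillSum, ← Finset.sum_fiberwise_of_maps_to
    (t := D.powerset.filter (IsStrip R₁ R₂ Q b D)) (g := inner)]
  · refine Finset.sum_congr rfl fun E hE => ?_
    obtain ⟨hED, hE⟩ := Finset.mem_filter.1 hE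
    rw [Finset.mem_powerset] at hED
    rw [fillSum, Finset.mul_sum]
    refine Finset.sum_bij' (fun T _ => fun c => T ⟨c.1, hED c.2⟩)
      (fun T' _ => fun c => if h : c.1 ∈ E then T' ⟨c.1, h⟩ else b) ?_ ?_ ?_ ?_ ?_
    · intro T hT
      simp only [Finset.mem_filter, Finset.mem_univ, true_and] at hT ⊢
      obtain ⟨⟨hT, hA⟩, rfl⟩ := hT
      exact ⟨⟨fun c d h => hT.weak _ _ h, fun c d h => hT.strict _ _ h,
        fun c => hT.entry ⟨c.1, hED c.2⟩⟩,
        fun c => ((mem_inner T c.1).1 c.2).2⟩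
    · intro T' hT'
      simp only [Finset.mem_filter, Finset.mem_univ, true_and] at hT' ⊢
      obtain ⟨hT, hA⟩ := hT'
      have hle : ∀ d : {c : ℕ × ℕ // c ∈ D},
          (if h : d.1 ∈ E then T' ⟨d.1, h⟩ else b) ≤ b := by
        intro d
        split_ifs with h
        exacts [(hb _ (hA _)).le, le_rfl]
      refine ⟨⟨⟨?_, ?_, ?_⟩, ?_⟩, ?_⟩
      · intro c d h
        by_cases hd : d.1 ∈ E
        · have hc := hE.weak _ c.2 _ hd h
          simpa [hc, hd] using hT.weak ⟨c.1, hc⟩ ⟨d.1, hd⟩ h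
        · simpa [hd] using hle c
      · intro c d h
        have hc := hE.strict _ c.2 _ d.2 h
        by_cases hd : d.1 ∈ E
        · simpa [hc, hd] using hT.strict ⟨c.1, hc⟩ ⟨d.1, hd⟩ h
        · simpa [hd, hc] using hb _ (hA ⟨c.1, hc⟩)
      · intro c
        by_cases hc : c.1 ∈ E
        · simpa [hc] using hT.entry ⟨c.1, hc⟩
        · simpa [hc] using hE.entry _ c.2 hc
      · intro c
        by_cases hc : c.1 ∈ E
        · simpa [hc] using Or.inr (hA ⟨c.1, hc⟩)
        · simp [hc]
      · ext c
        refine (mem_inner _ c).trans ⟨?_, ?_⟩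
        · rintro ⟨h, h'⟩
          by_contra hc
          simp [hc, hbA] at h'
        · intro hc
          exact ⟨hED hc, by simpa only [hc, dite_true] using hA ⟨c, hc⟩⟩
    · intro T hT
      simp only [Finset.mem_filter, Finset.mem_univ, true_and] at hT
      obtain ⟨⟨hT, hA⟩, rfl⟩ := hT
      funext c
      by_cases hc : c.1 ∈ inner T
      · simp [hc]
      · simp only [hc, dite_false]
        rcases Finset.mem_insert.1 (hA c) with h | h
        · exact h.symm
        · exact absurd ((mem_inner T c.1).2 ⟨c.2, h⟩) hc
    · intro T' hT'
      funext c
      simp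
    · intro T hT
      simp only [Finset.mem_filter, Finset.mem_univ, true_and] at hT
      obtain ⟨⟨hT, hA⟩, rfl⟩ := hT
      rw [Finset.prod_insert hbA]
      congr 1
      · congr 1
        ext c
        rw [mem_cellsOf, Finset.mem_sdiff, mem_inner]
        constructor
        · rintro ⟨h, h'⟩
          exact ⟨h, fun h'' => hbA (h' ▸ h''.2)⟩
        · rintro ⟨h, h'⟩
          refine ⟨h, (Finset.mem_insert.1 (hA ⟨c, h⟩)).resolve_right fun h'' => h' ⟨h, h''⟩⟩
      · refine Finset.prod_congr rfl fun a ha => ?_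
        congr 1
        ext c
        simp only [mem_cellsOf]
        constructor
        · rintro ⟨h, h'⟩
          exact ⟨(mem_inner T c).2 ⟨h, h' ▸ ha⟩, h'⟩
        · rintro ⟨h, h'⟩
          exact ⟨hED h, h'⟩
  · intro T hT
    simp only [Finset.mem_filter, Finset.mem_univ, true_and] at hT
    obtain ⟨hT, hA⟩ := hT
    have hnot : ∀ c, c ∉ inner T → ∀ h : c ∈ D, T ⟨c, h⟩ = b := by
      intro c hc h
      exact (Finset.mem_insert.1 (hA ⟨c, h⟩)).resolve_right fun h'' => hc ((mem_inner T c).2 ⟨h, h''⟩)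
    have hlt : ∀ c, ∀ h : c ∈ D, T ⟨c, h⟩ < b → c ∈ inner T := by
      intro c h hc
      by_contra h'
      exact (hnot c h' h ▸ hc).false
    have hle : ∀ c, T c ≤ b := by
      intro c
      rcases Finset.mem_insert.1 (hA c) with h | h
      exacts [h.le, (hb _ h).le]
    refine Finset.mem_filter.2 ⟨Finset.mem_powerset.2 (fun c hc => ((mem_inner T c).1 hc).1), ?_, ?_, ?_⟩
    · intro c hc d hd h
      obtain ⟨hd, hd'⟩ := (mem_inner T d).1 hd
      exact hlt c hc ((hT.weak ⟨c, hc⟩ ⟨d, hd⟩ h).trans_lt (hb _ hd'))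
    · intro c hc d hd h
      exact hlt c hc ((hT.strict ⟨c, hc⟩ ⟨d, hd⟩ h).trans_le (hle _))
    · intro c hc hc'
      exact hnot c hc' hc ▸ hT.entry ⟨c, hc⟩

end fillSum

/-! ### Strips in row diagrams as interlacing sequences. -/

/-- The diagram with rows of lengths `ν 0, …, ν (k - 1)`, row `i` starting in column `o i`. -/
def rowCells {k : ℕ} (o : ℕ → ℕ) (ν : Fin k → ℕ) : Finset (ℕ × ℕ) :=
  Finset.univ.biUnion fun i : Fin k => (Finset.range (ν i)).image fun j : ℕ => ((i : ℕ), o i + j)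

theorem mem_rowCells {k : ℕ} {o : ℕ → ℕ} {ν : Fin k → ℕ} {c : ℕ × ℕ} :
    c ∈ rowCells o ν ↔ ∃ i : Fin k, c.1 = i ∧ o i ≤ c.2 ∧ c.2 < o i + ν i := by
  obtain ⟨a, b⟩ := c
  simp only [rowCells, Finset.mem_biUnion, Finset.mem_univ, true_and, Finset.mem_image,
    Finset.mem_range, Prod.mk.injEq]
  refine exists_congr fun i => ⟨?_, ?_⟩
  · rintro ⟨j, hj, rfl, rfl⟩
    omega
  · rintro ⟨rfl, h₁, h₂⟩
    exact ⟨b - o i, by omega, rfl, by omega⟩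

theorem mk_mem_rowCells {k : ℕ} {o : ℕ → ℕ} {ν : Fin k → ℕ} {i : Fin k} {j : ℕ} :
    ((i : ℕ), j) ∈ rowCells o ν ↔ o i ≤ j ∧ j < o i + ν i := by
  rw [mem_rowCells]
  constructor
  · rintro ⟨i', h, h'⟩
    rwa [Fin.ext h]
  · exact fun h => ⟨i, rfl, h⟩

theorem rowCells_injective {k : ℕ} (o : ℕ → ℕ) :
    Function.Injective (rowCells o : (Fin k → ℕ) → Finset (ℕ × ℕ)) := by
  intro ν κ h
  funext i
  have key : ∀ j, (o i ≤ j ∧ j < o i + ν i) ↔ (o i ≤ j ∧ j < o i + κ i) := by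
    intro j
    rw [← mk_mem_rowCells, ← mk_mem_rowCells, h]
  have h₁ := key (o i + ν i)
  have h₂ := key (o i + κ i)
  omega

theorem rowCells_subset {k : ℕ} {o : ℕ → ℕ} {ν κ : Fin k → ℕ} (h : κ ≤ ν) :
    rowCells o κ ⊆ rowCells o ν := by
  intro c hc
  rw [mem_rowCells] at hc ⊢
  obtain ⟨i, h₁, h₂, h₃⟩ := hc
  exact ⟨i, h₁, h₂, h₃.trans_le (Nat.add_le_add_left (h i) _)⟩

theorem exists_eq_Ico_of_closed {a : ℕ} {s : Finset ℕ} (h₁ : ∀ j ∈ s, a ≤ j)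
    (h₂ : ∀ j ∈ s, ∀ j', a ≤ j' → j' ≤ j → j' ∈ s) : ∃ m, s = Finset.Ico a (a + m) := by
  rcases s.eq_empty_or_nonempty with rfl | hs
  · exact ⟨0, by simp⟩
  · have hmax := s.max'_mem hs
    refine ⟨s.max' hs + 1 - a, ?_⟩
    have := h₁ _ hmax
    ext j
    rw [Finset.mem_Ico]
    constructor
    · intro hj
      have := h₁ j hj
      have := s.le_max' j hj
      omega
    · rintro ⟨h, h'⟩
      exact h₂ _ hmax j h (by omega)

theorem exists_eq_rowCells {k : ℕ} {o : ℕ → ℕ} {ν : Fin k → ℕ} {E : Finset (ℕ × ℕ)}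
    (hE : E ⊆ rowCells o ν)
    (hc : ∀ c ∈ rowCells o ν, ∀ d ∈ E, c.1 = d.1 → c.2 ≤ d.2 → c ∈ E) :
    ∃ κ ≤ ν, E = rowCells o κ := by
  have key : ∀ i : Fin k, ∃ m ≤ ν i, ∀ j, ((i : ℕ), j) ∈ E ↔ o i ≤ j ∧ j < o i + m := by
    intro i
    have hmem : ∀ j, j ∈ (E.filter fun c => c.1 = (i : ℕ)).image Prod.snd ↔ ((i : ℕ), j) ∈ E := by
      intro j
      simp only [Finset.mem_image, Finset.mem_filter, Prod.exists]
      constructor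
      · rintro ⟨a, b, ⟨h, rfl⟩, rfl⟩
        exact h
      · exact fun h => ⟨i, j, ⟨h, rfl⟩, rfl⟩
    have hD : ∀ j, ((i : ℕ), j) ∈ E → o i ≤ j ∧ j < o i + ν i := fun j hj => by
      have := hE hj
      rwa [mk_mem_rowCells] at this
    obtain ⟨m, hm⟩ : ∃ m, (E.filter fun c => c.1 = (i : ℕ)).image Prod.snd =
        Finset.Ico (o i) (o i + m) := by
      apply exists_eq_Ico_of_closed
      · intro j hj
        rw [hmem] at hj
        exact (hD j hj).1
      · intro j hj j' h h'
        rw [hmem] at hj ⊢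
        have := hD j hj
        have hj' : ((i : ℕ), j') ∈ rowCells o ν := by
          rw [mk_mem_rowCells]
          omega
        exact hc _ hj' _ hj rfl h'
    have hm' : ∀ j, ((i : ℕ), j) ∈ E ↔ o i ≤ j ∧ j < o i + m := by
      intro j
      rw [← hmem, hm, Finset.mem_Ico]
    refine ⟨m, ?_, hm'⟩
    by_contra hlt
    have h₁ := (hm' (o i + ν i)).2 (by omega)
    have := hD _ h₁
    omega
  choose κ hκ hκ' using key
  refine ⟨κ, hκ, ?_⟩
  ext ⟨a, b⟩
  constructor
  · intro h
    obtain ⟨i, hi, -⟩ := mem_rowCells.1 (hE h)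
    dsimp only at hi
    subst hi
    exact mk_mem_rowCells.2 ((hκ' i b).1 h)
  · intro h
    obtain ⟨i, hi, -⟩ := mem_rowCells.1 h
    dsimp only at hi
    subst hi
    exact (hκ' i b).2 (mk_mem_rowCells.1 h)

/-- The length of the row following row `i`, zero if there is none. -/
def nextRow {k : ℕ} (ν : Fin k → ℕ) (i : Fin k) : ℕ :=
  if h : (i : ℕ) + 1 < k then ν ⟨i + 1, h⟩ else 0

theorem le_nextRow {k : ℕ} {ν : Fin k → ℕ} (hν : Antitone ν) {i j : Fin k} (h : i < j) :
    ν j ≤ nextRow ν i := by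
  have hi : (i : ℕ) + 1 < k := lt_of_le_of_lt (Fin.lt_def.1 h) j.2
  rw [nextRow, dif_pos hi]
  exact hν (Fin.mk_le_of_le_val (Fin.lt_def.1 h))

theorem nextRow_le {k : ℕ} {ν : Fin k → ℕ} (hν : Antitone ν) (i : Fin k) :
    nextRow ν i ≤ ν i := by
  rw [nextRow]
  split_ifs with h
  · exact hν (Fin.le_def.2 (by simp))
  · exact Nat.zero_le _

/-- The sequences `κ` interlacing with `ν`. -/
def interlacing {k : ℕ} (ν : Fin k → ℕ) : Finset (Fin k → ℕ) :=
  Fintype.piFinset fun i => Finset.Icc (nextRow ν i) (ν i)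

theorem mem_interlacing {k : ℕ} {ν κ : Fin k → ℕ} :
    κ ∈ interlacing ν ↔ ∀ i, nextRow ν i ≤ κ i ∧ κ i ≤ ν i := by
  simp [interlacing]

theorem antitone_of_mem_interlacing {k : ℕ} {ν κ : Fin k → ℕ} (hν : Antitone ν)
    (h : κ ∈ interlacing ν) : Antitone κ := by
  rw [mem_interlacing] at h
  intro i j hij
  rcases hij.eq_or_lt with rfl | hij
  · exact le_rfl
  · exact ((h j).2.trans (le_nextRow hν hij)).trans (h i).1

open Classical in
theorem sum_isStrip {K : Type*} [CommRing K] {n k : ℕ} {R₁ R₂ : ℕ × ℕ → ℕ × ℕ → Prop}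
    {Q : ℕ × ℕ → Letter n → Prop} {o : ℕ → ℕ} (hR : ∀ c d : ℕ × ℕ, c.1 = d.1 → c.2 ≤ d.2 → R₁ c d)
    {b : Letter n} {ν : Fin k → ℕ} {S : Finset (Fin k → ℕ)}
    (hS : ∀ κ, κ ∈ S ↔ κ ≤ ν ∧ IsStrip R₁ R₂ Q b (rowCells o ν) (rowCells o κ))
    (F : Finset (ℕ × ℕ) → K) :
    ∑ E ∈ (rowCells o ν).powerset with IsStrip R₁ R₂ Q b (rowCells o ν) E, F E =
      ∑ κ ∈ S, F (rowCells o κ) := by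
  symm
  refine Finset.sum_bij (fun κ _ => rowCells o κ) ?_ ?_ ?_ ?_
  · intro κ hκ
    rw [hS] at hκ
    exact Finset.mem_filter.2 ⟨Finset.mem_powerset.2 (rowCells_subset hκ.1), hκ.2⟩
  · exact fun _ _ _ _ h => rowCells_injective o h
  · intro E hE
    obtain ⟨h₁, h₂⟩ := Finset.mem_filter.1 hE
    obtain ⟨κ, hκ, rfl⟩ := exists_eq_rowCells (Finset.mem_powerset.1 h₁)
      fun c hc d hd h h' => h₂.weak c hc d hd (hR _ _ h h')
    exact ⟨κ, (hS κ).2 ⟨hκ, h₂⟩, rfl⟩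
  · exact fun _ _ => rfl

/-- Two boxes of the same row, the first one weakly to the left. -/
def SameRow (c d : ℕ × ℕ) : Prop := c.1 = d.1 ∧ c.2 ≤ d.2

/-- Two boxes of the same column, the first one strictly above. -/
def StrictlyAbove (c d : ℕ × ℕ) : Prop := c.2 = d.2 ∧ c.1 < d.1

/-- Two boxes of the same row or column, the first one weakly to the left and weakly above. -/
def SameRowOrCol (c d : ℕ × ℕ) : Prop := (c.1 = d.1 ∧ c.2 ≤ d.2) ∨ (c.2 = d.2 ∧ c.1 ≤ d.1)

/-- Two boxes of the same diagonal, the first one strictly above. -/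
def SameDiag (c d : ℕ × ℕ) : Prop := ∃ m, 0 < m ∧ d.1 = c.1 + m ∧ d.2 = c.2 + m

/-- The entry `a` is allowed in the row of the box `c` of a symplectic tableau. -/
def RowBound {n : ℕ} (c : ℕ × ℕ) (a : Letter n) : Prop := c.1 ≤ (a.index : ℕ)

/-- The entry `a` is allowed in the box `c` by the condition on the main diagonal. -/
def DiagEntry {n : ℕ} (c : ℕ × ℕ) (a : Letter n) : Prop := c.1 = c.2 → (a.index : ℕ) = c.1

/-- Interlacing says that the strip has at most one box in each column. The row bound costs nothing,
since `b` has index `m` and there are only `m + 1` rows. -/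
theorem mem_interlacing_iff_isStrip {n m : ℕ} {b : Letter n} (hb : (b.index : ℕ) = m)
    {ν : Fin (m + 1) → ℕ} (hν : Antitone ν) (κ : Fin (m + 1) → ℕ) :
    κ ∈ interlacing ν ↔ κ ≤ ν ∧ IsStrip SameRow StrictlyAbove RowBound b
      (rowCells (fun _ => 0) ν) (rowCells (fun _ => 0) κ) := by
  constructor
  · intro h
    rw [mem_interlacing] at h
    refine ⟨fun i => (h i).2, ?_, ?_, ?_⟩
    · rintro ⟨a, j⟩ hc ⟨a', j'⟩ hd ⟨h₁, h₂⟩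
      dsimp only at h₁ h₂
      subst h₁
      rw [mem_rowCells] at hd ⊢
      obtain ⟨i, hi, hi'⟩ := hd
      exact ⟨i, hi, by dsimp only at *; omega⟩
    · rintro ⟨a, j⟩ hc ⟨a', j'⟩ hd ⟨h₁, h₂⟩
      dsimp only at h₁ h₂
      subst h₁
      rw [mem_rowCells] at hc hd ⊢
      obtain ⟨i, hi, hi'⟩ := hd
      obtain ⟨l, hl, hl'⟩ := hc
      dsimp only at *
      have hli : l < i := Fin.lt_def.2 (by omega)
      have := le_nextRow hν hli
      have := (h l).1
      exact ⟨l, hl, by omega⟩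
    · rintro c hc -
      obtain ⟨i, hi, -⟩ := mem_rowCells.1 hc
      have := i.2
      simp only [RowBound]
      omega
  · rintro ⟨h, hs⟩
    rw [mem_interlacing]
    refine fun i => ⟨?_, h i⟩
    rw [nextRow]
    split_ifs with hi
    · by_contra! hlt
      have h₁ := hs.strict ((i : ℕ), κ i)
        (mk_mem_rowCells.2 ⟨Nat.zero_le _, by
          have : ν ⟨i + 1, hi⟩ ≤ ν i := hν (Fin.le_def.2 (by simp))
          omega⟩) (((⟨i + 1, hi⟩ : Fin (m + 1)) : ℕ), κ i)
        (mk_mem_rowCells.2 ⟨Nat.zero_le _, by omega⟩) ⟨rfl, by simp⟩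
      have := mk_mem_rowCells.1 h₁
      omega
    · exact Nat.zero_le _

/-- In a shifted diagram row `i` ends just before column `i + κ i`, so strict decrease of the
lengths means that the right ends move weakly to the left going down. -/
theorem add_sub_le_of_strictAnti {k : ℕ} {κ : Fin k → ℕ} (h : StrictAnti κ) {i j : Fin k}
    (hij : i ≤ j) : κ j + (j : ℕ) ≤ κ i + i := by
  obtain ⟨d, hd⟩ := Nat.exists_eq_add_of_le (Fin.le_def.1 hij)
  induction d generalizing j with
  | zero => rw [Fin.ext (show (j : ℕ) = i by omega)]
  | succ d ih =>
    have := j.2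
    have h₁ := ih (j := ⟨i + d, by omega⟩) (Fin.le_def.2 (by simp)) rfl
    have h₂ := h (a := ⟨i + d, by omega⟩) (b := j) (Fin.lt_def.2 (by simp; omega))
    simp only at h₁
    omega

-- Interlacing corresponds to having no two strip boxes on a diagonal. Strictness of `κ` comes from
-- the column condition and, where `κ` would have two zeros, from the main diagonal condition.
open Classical in
theorem mem_interlacing_strictAnti_iff_isStrip {n m : ℕ} {b : Letter n} (hb : (b.index : ℕ) = m)
    {ν : Fin (m + 1) → ℕ} (hν : StrictAnti ν) (κ : Fin (m + 1) → ℕ) :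
    κ ∈ (interlacing ν).filter StrictAnti ↔ κ ≤ ν ∧ IsStrip SameRowOrCol SameDiag DiagEntry b
      (rowCells id ν) (rowCells id κ) := by
  rw [Finset.mem_filter]
  constructor
  · rintro ⟨h, hκ⟩
    rw [mem_interlacing] at h
    refine ⟨fun i => (h i).2, ?_, ?_, ?_⟩
    · rintro ⟨a, j⟩ hc ⟨a', j'⟩ hd hR
      rw [mem_rowCells] at hc hd ⊢
      obtain ⟨l, hl, hl'⟩ := hc
      obtain ⟨i, hi, hi'⟩ := hd
      refine ⟨l, hl, ?_⟩
      have hli : l ≤ i := Fin.le_def.2 (by rcases hR with hR | hR <;> dsimp only at * <;> omega)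
      have := add_sub_le_of_strictAnti hκ hli
      rcases hR with hR | hR <;> simp only [id] at * <;> omega
    · rintro ⟨a, j⟩ hc ⟨a', j'⟩ hd ⟨d, hd₀, hd₁, hd₂⟩
      rw [mem_rowCells] at hc hd ⊢
      obtain ⟨l, hl, hl'⟩ := hc
      obtain ⟨i, hi, hi'⟩ := hd
      dsimp only [id] at *
      refine ⟨l, hl, ?_⟩
      have := le_nextRow hν.antitone (i := l) (j := i) (Fin.lt_def.2 (by omega))
      have := (h l).1
      omega
    · rintro ⟨a, j⟩ hc hc' hR
      rw [mem_rowCells] at hc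
      obtain ⟨l, hl, hl'⟩ := hc
      dsimp only [id] at *
      subst hR hl
      rw [mk_mem_rowCells] at hc'
      by_contra hne
      have hlt : l < Fin.last m := Fin.lt_def.2 (by have := l.2; simp; omega)
      have := hκ hlt
      simp only [id] at hc'
      omega
  · rintro ⟨h, hs⟩
    have hstep : ∀ i : Fin (m + 1), ∀ hi : (i : ℕ) + 1 < m + 1,
        ν ⟨i + 1, hi⟩ < ν i := fun i hi => hν (Fin.lt_def.2 (by simp))
    refine ⟨?_, ?_⟩
    · rw [mem_interlacing]
      refine fun i => ⟨?_, h i⟩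
      rw [nextRow]
      split_ifs with hi
      · by_contra! hlt
        -- The first strip box of row `i` would have its lower right diagonal neighbour still in the
        -- diagram.
        have h₁ := hs.strict ((i : ℕ), i + κ i)
          (mk_mem_rowCells.2 ⟨Nat.le_add_right _ _, by have := hstep i hi; simp only [id]; omega⟩)
          (((⟨i + 1, hi⟩ : Fin (m + 1)) : ℕ), i + κ i + 1)
          (mk_mem_rowCells.2 ⟨by simp only [id]; omega, by simp only [id]; omega⟩)
          ⟨1, one_pos, rfl, rfl⟩
        have := mk_mem_rowCells.1 h₁
        simp only [id] at this
        omega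
      · exact Nat.zero_le _
    · rw [Fin.strictAnti_iff_succ_lt]
      intro i
      by_contra! hle
      have hν' : ν i.succ < ν i.castSucc := hν (Fin.castSucc_lt_succ)
      have hκ' : κ i.succ ≤ ν i.succ := h _
      rcases Nat.eq_zero_or_pos (κ i.succ) with h₀ | h₀
      -- Here row `i` is emptied too, so its main diagonal box would receive a letter of index `m`
      -- instead of `i < m`.
      · have := hs.entry (((i.castSucc : Fin (m + 1)) : ℕ), (i : ℕ))
          (mk_mem_rowCells.2 (by simp; omega)) (by rw [mk_mem_rowCells]; simp; omega) rfl
        have := i.2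
        rw [Fin.val_castSucc] at *
        omega
      -- The lower box is the last remaining box of row `i + 1`; the box above it must also remain.
      · have := hs.weak (((i.castSucc : Fin (m + 1)) : ℕ), i + κ i.succ)
          (mk_mem_rowCells.2 (by simp; omega)) (((i.succ : Fin (m + 1)) : ℕ), i + κ i.succ)
          (mk_mem_rowCells.2 (by simp; omega)) (Or.inr ⟨rfl, by simp⟩)
        rw [mk_mem_rowCells] at this
        simp at this
        omega

open PowerSeries

/-! ### Multilinearity, row operations and convolution. -/

section determinants

variable {K : Type*} [CommRing K]

/-- Reversing the order of the rows turns this into the row operation that uses the preceding row.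
-/
theorem det_eq_of_forall_row_eq_sub_next {m : ℕ} {A B : Matrix (Fin (m + 1)) (Fin (m + 1)) K}
    (c : Fin m → K) (hlast : ∀ j, A (Fin.last m) j = B (Fin.last m) j)
    (h : ∀ (i : Fin m) j, A i.castSucc j = B i.castSucc j - c i * B i.succ j) :
    A.det = B.det := by
  rw [← Matrix.det_submatrix_equiv_self Fin.revPerm A,
    ← Matrix.det_submatrix_equiv_self Fin.revPerm B]
  symm
  refine Matrix.det_eq_of_forall_row_eq_smul_add_pred (fun i => c i.rev) ?_ ?_
  · intro j
    simp [hlast]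
  · intro i j
    simp [Fin.rev_succ, Fin.rev_castSucc, h]

theorem sum_piFinset_mul_det {ι : Type*} [Fintype ι] [DecidableEq ι] (S : ι → Finset ℕ)
    (w : ι → ℕ → K) (g : ι → ι → ℕ → K) :
    ∑ κ ∈ Fintype.piFinset S, (∏ i, w i (κ i)) * (Matrix.of fun i j => g i j (κ i)).det =
      (Matrix.of fun i j => ∑ q ∈ S i, w i q * g i j q).det := by
  have h := (Matrix.detRowAlternating (R := K) (n := ι)).toMultilinearMap.map_sum_finset
    (fun i q j => w i q * g i j q) S
  have h₁ : (fun i => ∑ q ∈ S i, fun j => w i q * g i j q) =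
      (Matrix.of fun i j => ∑ q ∈ S i, w i q * g i j q) := by
    funext i j
    simp [Finset.sum_apply]
  rw [h₁] at h
  refine Eq.trans ?_ h.symm
  refine Finset.sum_congr rfl fun κ _ => ?_
  rw [← Matrix.det_mul_column]
  rfl

/-- The contribution of a row to the weight of a strip, where the row shrinks from length `a` to
length `q` and the next row has length `b`. -/
def stripWeight (z y u : K) (a b q : ℕ) : K :=
  if q = a then 1 else if q = b then (if b = 0 then u else y) * z ^ (a - q - 1)
  else (z + y) * z ^ (a - q - 1)

/-- The sum of `h` against the weights of a strip in the last row. -/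
def stripSum (z y u : K) (h : ℕ → K) (a : ℕ) : K :=
  ∑ q ∈ Finset.range (a + 1), stripWeight z y u a 0 q * h q

/-- For $q<b$ the weights of a row of length $a$ are $z^{a-b}$ times those of a row of length $b$,
so they cancel. At $q=b$ there remains $(z+y)z^{a-b-1}-z^{a-b}=yz^{a-b-1}$, which is the weight of a
row joined to the next one. For $b=0$ the interval is already complete. -/
theorem sum_stripWeight (z y u : K) (h : ℕ → K) {a b : ℕ} (hab : b < a) :
    ∑ q ∈ Finset.Icc b a, stripWeight z y u a b q * h q =
      stripSum z y u h a - (if b = 0 then 0 else z ^ (a - b)) * stripSum z y u h b := by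
  rcases Nat.eq_zero_or_pos b with rfl | hb
  · have : Finset.Icc 0 a = Finset.range (a + 1) := by
      ext
      simp
    simp [stripSum, this]
  · rw [if_neg hb.ne', stripSum, stripSum, Finset.mul_sum, Finset.sum_range_succ _ b,
      ← Finset.sum_range_add_sum_Ico _ (show b ≤ a + 1 by omega),
      Finset.sum_eq_sum_Ico_succ_bot (show b < a + 1 by omega)]
    have hIcc : Finset.Icc b a = Finset.Ico b (a + 1) := by
      ext
      simp
    rw [hIcc, Finset.sum_eq_sum_Ico_succ_bot (show b < a + 1 by omega)]
    have h₁ : ∑ q ∈ Finset.range b, stripWeight z y u a 0 q * h q =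
        ∑ q ∈ Finset.range b, z ^ (a - b) * (stripWeight z y u b 0 q * h q) := by
      refine Finset.sum_congr rfl fun q hq => ?_
      have hq := Finset.mem_range.1 hq
      have hp : z ^ (a - q - 1) = z ^ (a - b) * z ^ (b - q - 1) := by
        rw [← pow_add]
        congr 1
        omega
      simp only [stripWeight, if_neg (show q ≠ a by omega), if_neg hq.ne, hp]
      split_ifs <;> ring
    have h₂ : ∑ q ∈ Finset.Ico (b + 1) (a + 1), stripWeight z y u a b q * h q =
        ∑ q ∈ Finset.Ico (b + 1) (a + 1), stripWeight z y u a 0 q * h q := by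
      refine Finset.sum_congr rfl fun q hq => ?_
      have hq := Finset.mem_Ico.1 hq
      simp only [stripWeight, if_neg (show q ≠ b by omega), if_neg (show q ≠ 0 by omega)]
    have h₃ : z ^ (a - b) = z * z ^ (a - b - 1) := by
      rw [← pow_succ']
      congr 1
      omega
    rw [h₁, h₂]
    simp only [stripWeight, if_neg hab.ne, if_neg hb.ne', if_true, h₃]
    ring

theorem det_stripWeight (z y u : K) {m : ℕ} {ν : Fin (m + 1) → ℕ} (hν : StrictAnti ν)
    (g : Fin (m + 1) → ℕ → K) :
    (Matrix.of fun i j => ∑ q ∈ Finset.Icc (nextRow ν i) (ν i),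
      stripWeight z y u (ν i) (nextRow ν i) q * g j q).det =
      (Matrix.of fun i j => stripSum z y u (g j) (ν i)).det := by
  refine det_eq_of_forall_row_eq_sub_next (fun i => if ν i.succ = 0 then 0 else
    z ^ (ν i.castSucc - ν i.succ)) ?_ ?_
  · intro j
    have h : nextRow ν (Fin.last m) = 0 := by simp [nextRow]
    have : Finset.Icc 0 (ν (Fin.last m)) = Finset.range (ν (Fin.last m) + 1) := by
      ext
      simp
    simp only [Matrix.of_apply, h, stripSum, this]
  · intro i j
    have h : nextRow ν i.castSucc = ν i.succ := by
      rw [nextRow, dif_pos (by simp)]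
      rfl
    simp only [Matrix.of_apply, h]
    exact sum_stripWeight z y u (g j) (hν Fin.castSucc_lt_succ)

-- The sum may be extended to all interlacing `κ`: a `κ` that is not strict has two equal
-- consecutive parts, and its determinant has two equal rows.
open Classical in
theorem sum_interlacing_stripWeight (z y u : K) {m : ℕ} {ν : Fin (m + 1) → ℕ} (hν : StrictAnti ν)
    (g : Fin (m + 1) → ℕ → K) :
    ∑ κ ∈ interlacing ν with StrictAnti κ, (∏ i, stripWeight z y u (ν i) (nextRow ν i) (κ i)) *
        (Matrix.of fun i j => g j (κ i)).det =
      (Matrix.of fun i j => stripSum z y u (g j) (ν i)).det := by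
  rw [← det_stripWeight z y u hν, ← sum_piFinset_mul_det _ _ fun _ => g, ← interlacing]
  refine Finset.sum_subset (Finset.filter_subset _ _) fun κ hκ hκ' => ?_
  have hanti := antitone_of_mem_interlacing hν.antitone hκ
  have hns : ¬ StrictAnti κ := fun h => hκ' (Finset.mem_filter.2 ⟨hκ, h⟩)
  rw [Fin.strictAnti_iff_succ_lt] at hns
  push Not at hns
  obtain ⟨i, hi⟩ := hns
  have heq : κ i.castSucc = κ i.succ := le_antisymm hi (hanti Fin.castSucc_lt_succ.le)
  rw [Matrix.det_zero_of_row_eq (Fin.castSucc_lt_succ (i := i)).ne, mul_zero]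
  funext j
  simp [heq]

/-- The power series `(1 + y w) / (1 - z w)`. -/
def ratio (z y : K) : PowerSeries K :=
  PowerSeries.mk fun m => if m = 0 then 1 else (z + y) * z ^ (m - 1)

theorem ratio_mul (z y : K) : ratio z y * (1 - C z * X) = 1 + C y * X := by
  ext m
  rw [mul_sub, mul_one, ← mul_assoc, mul_comm _ (C z), mul_assoc]
  rcases m with _ | _ | m
  · simp [ratio]
  · simp [ratio, coeff_succ_mul_X, coeff_one]
  · simp [ratio, coeff_succ_mul_X, coeff_one, pow_succ']
    ring

/-- The strip weights are the coefficients of `ratio z y`, except at `q = 0`, where `u` replaces `z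
+ y`; the correction vanishes for series without constant term. -/
theorem stripSum_coeff (z y u : K) (f : PowerSeries K) (a : ℕ) :
    stripSum z y u (fun q => coeff q f) a = coeff a (ratio z y * f) -
      if a = 0 then 0 else (z + y - u) * z ^ (a - 1) * coeff 0 f := by
  rw [stripSum, mul_comm, coeff_mul, Finset.Nat.sum_antidiagonal_eq_sum_range_succ
    (fun i j => coeff i f * coeff j (ratio z y)), Finset.sum_range_succ', Finset.sum_range_succ']
  have h : ∀ q ∈ Finset.range a, stripWeight z y u a 0 (q + 1) * coeff (q + 1) f =
      coeff (q + 1) f * coeff (a - (q + 1)) (ratio z y) := by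
    intro q hq
    have hq := Finset.mem_range.1 hq
    simp only [stripWeight, ratio, coeff_mk, if_neg (Nat.succ_ne_zero q)]
    split_ifs <;> first | omega | ring
  rw [Finset.sum_congr rfl h, add_sub_assoc]
  congr 1
  simp only [stripWeight, ratio, coeff_mk, Nat.sub_zero, if_true]
  split_ifs <;> first | omega | ring

end determinants

/-! ### The column series and how they change when a pair of letters is added. -/

section columns

variable {K : Type*} [CommRing K]

/-- Adding the staircase makes the parts strict and turns the intervals $[\nu_{i+1},\nu_i]$ into
half-open ones. The excluded lower end has weight zero when $y=u=0$, so the row operations for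
strict sequences apply. -/
theorem sum_strip_add_staircase (z : K) {m : ℕ} {ν : Fin (m + 1) → ℕ} (hν : Antitone ν)
    (f : Fin (m + 1) → PowerSeries K) (hf : ∀ j, coeff 0 (f j) = 0) :
    ∑ κ ∈ interlacing ν, (∏ i, z ^ (ν i - κ i)) *
        (Matrix.of fun i j => coeff (κ i + (m + 1 - i)) (f j)).det =
      (Matrix.of fun i j => coeff (ν i + (m + 1 - i)) (ratio z 0 * f j)).det := by
  set p : Fin (m + 1) → ℕ := fun i => ν i + (m + 1 - i) with hp
  have hpa : StrictAnti p := by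
    intro i j hij
    have := hν hij.le
    have := Fin.lt_def.1 hij
    simp only [hp]
    omega
  have hT : (Matrix.of fun i j => coeff (ν i + (m + 1 - i)) (ratio z 0 * f j)) =
      Matrix.of fun i j => stripSum z 0 0 (fun q => coeff q (f j)) (p i) := by
    ext i j
    simp only [Matrix.of_apply, stripSum_coeff, hf, mul_zero, ite_self, sub_zero, hp]
  rw [hT, ← det_stripWeight z 0 0 hpa, interlacing, sum_piFinset_mul_det _
    (fun i q => z ^ (ν i - q)) fun i j q => coeff (q + (m + 1 - i)) (f j)]
  congr 1
  ext i j
  have hi := i.2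
  have hnext : nextRow p i = nextRow ν i + (m - i) := by
    simp only [nextRow]
    split_ifs with h
    · simp only [hp]
      omega
    · omega
  have hle := nextRow_le hν i
  have hpi : p i = ν i + (m - i) + 1 := by
    simp only [hp]
    omega
  simp only [Matrix.of_apply]
  have hs : m + 1 - (i : ℕ) = m - i + 1 := by omega
  rw [hnext, hpi, hs]
  generalize m - (i : ℕ) = s
  generalize nextRow ν i = b at *
  generalize ν i = a at *
  have h₁ : Finset.Icc (b + s) (a + s + 1) = Finset.Ico (b + s) (a + s + 1 + 1) := by
    ext
    simp
  have h₂ : Finset.Icc b a = Finset.Ico b (a + 1) := by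
    ext
    simp
  rw [h₁, Finset.sum_eq_sum_Ico_succ_bot (by omega), h₂]
  -- The lower end of the shifted interval, which no interlacing `κ` reaches.
  have h₀ : stripWeight z 0 0 (a + s + 1) (b + s) (b + s) * coeff (b + s) (f j) = 0 := by
    simp [stripWeight, show b + s ≠ a + s + 1 by omega]
  rw [h₀, zero_add, show b + s + 1 = b + (s + 1) by omega,
    show a + s + 1 + 1 = a + 1 + (s + 1) by omega, ← Finset.sum_Ico_add']
  refine Finset.sum_congr rfl fun q hq => ?_
  have hq := Finset.mem_Ico.1 hq
  congr 1
  simp only [stripWeight, if_neg (show q + (s + 1) ≠ b + s by omega), add_zero]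
  split_ifs with h
  · rw [show a - q = 0 by omega, pow_zero]
  · rw [← pow_succ']
    congr 1
    omega

variable (x x' : ℕ → K) (t : K)

/-- The power series `1 / ((1 - x_k w) (1 - t² x_k⁻¹ w))`. -/
noncomputable def invQuad (k : ℕ) : PowerSeries K := ratio (x k) 0 * ratio (t ^ 2 * x' k) 0

/-- The generating functions of the columns of the determinants. -/
noncomputable def column (k j : ℕ) : PowerSeries K := ∏ i ∈ Finset.Ico j k, X * invQuad x x' t i

theorem column_self (k : ℕ) : column x x' t k k = 1 := by simp [column]

theorem column_succ {k j : ℕ} (h : j ≤ k) :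
    column x x' t (k + 1) j = X * invQuad x x' t k * column x x' t k j := by
  rw [column, Finset.prod_Ico_succ_top h, mul_comm]
  rfl

theorem coeff_zero_column {k j : ℕ} (h : j < k) : coeff 0 (column x x' t k j) = 0 := by
  rw [column, Finset.prod_eq_prod_Ico_succ_bot h]
  simp

theorem invQuad_mul (k : ℕ) :
    invQuad x x' t k * ((1 - C (x k) * X) * (1 - C (t ^ 2 * x' k) * X)) = 1 := by
  have h₁ := ratio_mul (x k) 0
  have h₂ := ratio_mul (t ^ 2 * x' k) 0
  rw [map_zero, zero_mul, add_zero] at h₁ h₂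
  rw [invQuad]
  linear_combination (ratio (t ^ 2 * x' k) 0 * (1 - C (t ^ 2 * x' k) * X)) * h₁ + h₂

theorem quad_mul_column {k j : ℕ} (h : j < k) :
    ((1 - C (x j) * X) * (1 - C (t ^ 2 * x' j) * X)) * column x x' t k j =
      X * column x x' t k (j + 1) := by
  rw [column, Finset.prod_eq_prod_Ico_succ_bot h, column]
  linear_combination (X * ∏ i ∈ Finset.Ico (j + 1) k, X * invQuad x x' t i) * invQuad_mul x x' t j

/-- Only the last column series has a constant term, so the last row is $(0,\dots,0,1)$. Together
with `det_column_eq_zero` this mirrors the combinatorics: letters of index below `k` cannot fill a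
shape with `k + 1` nonempty rows. -/
theorem det_column_castSucc {k : ℕ} {p : Fin (k + 1) → ℕ} (hp : p (Fin.last k) = 0) :
    (Matrix.of fun i j : Fin (k + 1) => coeff (p i) (column x x' t k j)).det =
      (Matrix.of fun i j : Fin k => coeff (p i.castSucc) (column x x' t k j)).det := by
  rw [Matrix.det_succ_row _ (Fin.last k), Fin.sum_univ_castSucc, Finset.sum_eq_zero, zero_add]
  · simp only [Matrix.of_apply, hp, Fin.val_last, column_self, coeff_zero_one, mul_one,
      Even.neg_one_pow (Even.add_self k), one_mul, Fin.succAbove_last]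
    rfl
  · intro j _
    simp only [Matrix.of_apply, hp, Fin.val_castSucc]
    rw [coeff_zero_column _ _ _ j.2]
    simp

theorem det_column_eq_zero {k : ℕ} {p : Fin (k + 1) → ℕ} (hp : ∀ i, p i ≠ 0) :
    (Matrix.of fun i j : Fin (k + 1) => coeff (p i) (column x x' t k j)).det = 0 := by
  refine Matrix.det_eq_zero_of_column_eq_zero (Fin.last k) fun i => ?_
  simp [column_self, coeff_one, hp i]

variable {x x'}

/-- The factors of the deformed Weyl denominator that involve `x_k` and `x_j` with `j < k`. -/
def factor (x x' : ℕ → K) (t : K) (j k : ℕ) : K := x j + t ^ 2 * x' j + t * x k + t * x' k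

/-- After clearing the common denominator, this compares $(1+tx_kw)(1+tx_k^{-1}w)$ with
$(1-x_jw)(1-t^2x_j^{-1}w)$. Both have constant term $1$ and quadratic coefficient $t^2$. -/
theorem ratio_mul_ratio_mul_column (hx : ∀ k, x k * x' k = 1) {k j : ℕ} (h : j < k) :
    ratio (x k) (t * x k) * (ratio (t ^ 2 * x' k) (t * x' k) * column x x' t k j) =
      column x x' t (k + 1) (j + 1) + C (factor x x' t j k) * column x x' t (k + 1) j := by
  have h₁ := ratio_mul (x k) (t * x k)
  have h₂ := ratio_mul (t ^ 2 * x' k) (t * x' k)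
  have h₃ := invQuad_mul x x' t k
  have h₄ := quad_mul_column x x' t h
  rw [column_succ x x' t h.le, column_succ x x' t h]
  set r₁ := ratio (x k) (t * x k)
  set r₂ := ratio (t ^ 2 * x' k) (t * x' k)
  set q := invQuad x x' t k
  set c := column x x' t k j
  set c' := column x x' t k (j + 1)
  have hk : C (x k) * C (x' k) = (1 : PowerSeries K) := by rw [← map_mul, hx, map_one]
  have hj : C (x j) * C (x' j) = (1 : PowerSeries K) := by rw [← map_mul, hx, map_one]
  simp only [factor, map_add, map_mul, map_pow] at *
  have h₅ : r₁ * r₂ = (1 + C t * C (x k) * X) * (1 + C t * C (x' k) * X) * q := by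
    linear_combination (-(r₁ * r₂)) * h₃ + q * r₂ * (1 - C t ^ 2 * C (x' k) * X) * h₁ +
      q * (1 + C t * C (x k) * X) * h₂
  rw [← mul_assoc, h₅]
  linear_combination q * h₄ + (q * c * C t ^ 2 * X ^ 2) * hk - (q * c * C t ^ 2 * X ^ 2) * hj

/-- The analogue for the last column, where `column x x' t k k = 1` and the boundary corrections
matter. The series `f` is what the barred strip makes of $1$, and the subtracted term is the
correction for the unbarred strip. -/
theorem ratio_mul_ratio_add (x x' : ℕ → K) (t : K) (k : ℕ) {f : PowerSeries K}
    (hf : f = 1 + C (t * x' k) * X * ratio (t ^ 2 * x' k) 0) :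
    ratio (x k) (t * x k) * f - C (t * x k) * X * ratio (x k) 0 =
      1 + C (x k + t * x' k) * column x x' t (k + 1) k := by
  subst hf
  have h₀ := ratio_mul (x k) 0
  have h₁ := ratio_mul (x k) (t * x k)
  have h₂ := ratio_mul (t ^ 2 * x' k) 0
  rw [map_zero, zero_mul, add_zero] at h₀ h₂
  rw [column_succ x x' t le_rfl, column_self, invQuad]
  have h₁' : ratio (x k) (t * x k) = (1 + C (t * x k) * X) * ratio (x k) 0 := by
    linear_combination ratio (x k) 0 * h₁ - ratio (x k) (t * x k) * h₀
  rw [h₁']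
  simp only [map_add, map_mul, map_pow] at *
  linear_combination h₀ - C (x k) * X * ratio (x k) 0 * h₂

/-- The condition `a ≠ 0` discards the constant term $1$ in `ratio_mul_ratio_add`. -/
theorem stripSum_stripSum_column (hx : ∀ k, x k * x' k = 1) {k a : ℕ} (ha : a ≠ 0)
    (j : Fin (k + 1)) :
    stripSum (x k) (t * x k) (x k) (stripSum (t ^ 2 * x' k) (t * x' k) (t * x' k)
      fun q => coeff q (column x x' t k j)) a =
    if (j : ℕ) = k then (x k + t * x' k) * coeff a (column x x' t (k + 1) j) else
      coeff a (column x x' t (k + 1) (j + 1)) +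
        factor x x' t j k * coeff a (column x x' t (k + 1) j) := by
  split_ifs with h
  · obtain ⟨f, hf⟩ : ∃ f, f = 1 + C (t * x' k) * X * ratio (t ^ 2 * x' k) 0 := ⟨_, rfl⟩
    have hf' : stripSum (t ^ 2 * x' k) (t * x' k) (t * x' k)
        (fun q => coeff q (column x x' t k j)) = fun q => coeff q f := by
      funext q
      rw [stripSum_coeff, h, column_self, hf]
      rcases q with _ | q
      · simp [ratio]
      · simp [ratio, mul_assoc, coeff_succ_X_mul, coeff_one]
        rcases q with _ | q
        · simp
        · simp [pow_succ']
          ring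
    generalize he : x k + t * x' k = e
    have key := congrArg (coeff a) (ratio_mul_ratio_add x x' t k hf)
    rw [he] at key
    rw [hf', stripSum_coeff, if_neg ha, h]
    obtain ⟨a, rfl⟩ := Nat.exists_eq_succ_of_ne_zero ha
    have h₀ : coeff 0 f = 1 := by simp [hf]
    rw [h₀]
    simp only [map_sub, map_add, mul_assoc, coeff_C_mul, Nat.succ_eq_add_one, coeff_succ_X_mul,
      coeff_one, ha, if_false, zero_add] at key
    have hr : coeff a (ratio (x k) 0) = x k ^ a := by
      rcases a with _ | a <;> simp [ratio, pow_succ']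
    rw [hr] at key
    rw [Nat.succ_eq_add_one, ← key]
    simp only [Nat.add_sub_cancel]
    ring
  · have hj : (j : ℕ) < k := by omega
    have hf' : stripSum (t ^ 2 * x' k) (t * x' k) (t * x' k)
        (fun q => coeff q (column x x' t k j)) =
          fun q => coeff q (ratio (t ^ 2 * x' k) (t * x' k) * column x x' t k j) := by
      funext q
      rw [stripSum_coeff, coeff_zero_column _ _ _ hj]
      simp
    rw [hf', stripSum_coeff, ratio_mul_ratio_mul_column t hx hj]
    have h₀ : coeff 0 (ratio (t ^ 2 * x' k) (t * x' k) * column x x' t k j) = 0 := by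
      have := coeff_zero_column x x' t hj
      rw [coeff_zero_eq_constantCoeff] at *
      rw [map_mul, this, mul_zero]
    simp only [h₀, mul_zero, ite_self, sub_zero, map_add, coeff_C_mul]

theorem det_stripSum_column (hx : ∀ k, x k * x' k = 1) {k : ℕ} {ν : Fin (k + 1) → ℕ}
    (hν : ∀ i, ν i ≠ 0) :
    (Matrix.of fun i j : Fin (k + 1) => stripSum (x k) (t * x k) (x k)
      (stripSum (t ^ 2 * x' k) (t * x' k) (t * x' k)
        fun q => coeff q (column x x' t k j)) (ν i)).det =
      ((x k + t * x' k) * ∏ j ∈ Finset.range k, factor x x' t j k) *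
        (Matrix.of fun i j : Fin (k + 1) => coeff (ν i) (column x x' t (k + 1) j)).det := by
  set d : ℕ → K := fun j => if j = k then x k + t * x' k else factor x x' t j k with hd
  -- The new matrix is the matrix of coefficients of `column x x' t (k + 1)` times this lower
  -- bidiagonal matrix; the denominator factors of stage `k` form its diagonal.
  set L : Matrix (Fin (k + 1)) (Fin (k + 1)) K := Matrix.of fun i j =>
    if i = j then d j else if (i : ℕ) = j + 1 then 1 else 0 with hL
  have hdet : L.det = (x k + t * x' k) * ∏ j ∈ Finset.range k, factor x x' t j k := by
    rw [Matrix.det_of_isLowerTriangular L, Fin.prod_univ_castSucc, mul_comm]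
    · simp only [hL, Matrix.of_apply, if_true, hd, Fin.val_last, Fin.val_castSucc]
      rw [Finset.prod_range]
      congr 1
      refine Finset.prod_congr rfl fun j _ => ?_
      rw [if_neg j.2.ne]
    · intro i j hij
      have hij : i < j := hij
      have := Fin.lt_def.1 hij
      simp only [hL, Matrix.of_apply, if_neg hij.ne, if_neg (show (i : ℕ) ≠ j + 1 by omega)]
  rw [← hdet, mul_comm L.det, ← Matrix.det_mul]
  congr 1
  ext i j
  rw [Matrix.of_apply, stripSum_stripSum_column t hx (hν i) j, Matrix.mul_apply]
  have hterm : ∀ l : Fin (k + 1), (Matrix.of fun i j : Fin (k + 1) =>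
      coeff (ν i) (column x x' t (k + 1) j)) i l * L l j =
      (if l = j then coeff (ν i) (column x x' t (k + 1) l) * d j else 0) +
        if (l : ℕ) = j + 1 then coeff (ν i) (column x x' t (k + 1) l) else 0 := by
    intro l
    simp only [hL, Matrix.of_apply]
    by_cases h₁ : l = j
    · subst h₁
      simp
    · split_ifs <;> simp
  rw [Finset.sum_congr rfl fun l _ => hterm l, Finset.sum_add_distrib, Finset.sum_ite_eq' _ j,
    if_pos (Finset.mem_univ _)]
  by_cases hj : (j : ℕ) = k
  · rw [if_pos hj, Finset.sum_eq_zero, add_zero, hd]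
    · simp only [if_pos hj, mul_comm]
    · intro l _
      rw [if_neg (by omega)]
  · have hj' : (j : ℕ) + 1 < k + 1 := by omega
    rw [if_neg hj, Finset.sum_eq_single ⟨j + 1, hj'⟩]
    · simp only [hd, if_neg hj, if_true]
      ring
    · intro l _ hl
      rw [if_neg fun h => hl (Fin.ext h)]
    · simp

end columns

/-! ### The alphabet and its initial segments. -/

section letters

variable {n : ℕ}

/-- The letters with underlying number less than `k` (zero-based). -/
def lettersBelow (n k : ℕ) : Finset (Letter n) := Finset.univ.filter fun a => (a.index : ℕ) < k

theorem mem_lettersBelow {k : ℕ} {a : Letter n} : a ∈ lettersBelow n k ↔ (a.index : ℕ) < k := by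
  simp [lettersBelow]

theorem lettersBelow_zero : lettersBelow n 0 = ∅ := by
  simp [lettersBelow]

theorem lettersBelow_self : lettersBelow n n = Finset.univ := by
  ext a
  simp [mem_lettersBelow]

theorem letter_eq (a : Letter n) : a = barred a.index ∨ a = unbarred a.index := by
  obtain ⟨i, b⟩ := a
  cases b
  exacts [Or.inl rfl, Or.inr rfl]

theorem lettersBelow_succ {k : ℕ} (h : k < n) :
    lettersBelow n (k + 1) =
      insert (unbarred ⟨k, h⟩) (insert (barred ⟨k, h⟩) (lettersBelow n k)) := by
  ext a
  simp only [mem_lettersBelow, Finset.mem_insert]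
  constructor
  · intro ha
    rcases Nat.lt_succ_iff_lt_or_eq.1 ha with ha | rfl
    · exact Or.inr (Or.inr ha)
    · rcases letter_eq a with h' | h'
      · exact Or.inr (Or.inl h')
      · exact Or.inl h'
  · rintro (rfl | rfl | h')
    · exact Nat.lt_succ_self k
    · exact Nat.lt_succ_self k
    · omega

theorem lt_of_index_lt {a b : Letter n} (h : a.index < b.index) : a < b :=
  Prod.Lex.lt_iff.2 (Or.inl h)

theorem barred_lt_unbarred (i : Fin n) : barred i < unbarred i :=
  Prod.Lex.lt_iff.2 (Or.inr ⟨rfl, Bool.false_lt_true⟩)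

theorem lt_barred {k : ℕ} {h : k < n} : ∀ a ∈ lettersBelow n k, a < barred ⟨k, h⟩ :=
  fun _ ha => lt_of_index_lt (mem_lettersBelow.1 ha)

theorem lt_unbarred {k : ℕ} {h : k < n} :
    ∀ a ∈ insert (barred ⟨k, h⟩) (lettersBelow n k), a < unbarred ⟨k, h⟩ := by
  intro a ha
  rcases Finset.mem_insert.1 ha with rfl | ha
  · exact barred_lt_unbarred _
  · exact lt_of_index_lt (mem_lettersBelow.1 ha)

end letters

theorem card_rowCells {k : ℕ} (o : ℕ → ℕ) (ν : Fin k → ℕ) : (rowCells o ν).card = ∑ i, ν i := by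
  rw [rowCells, Finset.card_biUnion]
  · refine Finset.sum_congr rfl fun i _ => ?_
    rw [Finset.card_image_of_injective _ fun a b h => by simpa using h, Finset.card_range]
  · intro i _ j _ hij
    rw [Function.onFun, Finset.disjoint_left]
    rintro c hc hc'
    obtain ⟨a, -, rfl⟩ := Finset.mem_image.1 hc
    obtain ⟨b, -, h⟩ := Finset.mem_image.1 hc'
    exact hij (Fin.ext (congrArg Prod.fst h).symm)

theorem card_rowCells_sdiff {k : ℕ} (o : ℕ → ℕ) {ν κ : Fin k → ℕ} (h : κ ≤ ν) :
    (rowCells o ν \ rowCells o κ).card = ∑ i, (ν i - κ i) := by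
  rw [Finset.card_sdiff_of_subset (rowCells_subset h), card_rowCells, card_rowCells,
    Finset.sum_tsub_distrib _ fun i _ => h i]

theorem rowCells_castSucc {k : ℕ} (o : ℕ → ℕ) {κ : Fin (k + 1) → ℕ} (h : κ (Fin.last k) = 0) :
    rowCells o κ = rowCells o fun i => κ i.castSucc := by
  ext c
  rw [mem_rowCells, mem_rowCells, Fin.exists_fin_succ', h]
  simp only [Fin.val_castSucc, add_zero, or_iff_left_iff_imp]
  omega

/-! ### The determinant for deformed symplectic characters. -/

section symplectic

variable {K : Type*} [CommRing K] {n : ℕ}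

/-- The contribution of the boxes with entry `a` to the deformed symplectic character. -/
def spWeight (x x' : ℕ → K) (t : K) (a : Letter n) (B : Finset (ℕ × ℕ)) : K :=
  (if (ofLex a).2 then x a.index else t ^ 2 * x' a.index) ^ B.card

theorem fillSum_insert_symplectic {g : Letter n → Finset (ℕ × ℕ) → K} {A : Finset (Letter n)}
    {b : Letter n} {k : ℕ} (hb : (b.index : ℕ) = k) (hA : ∀ a ∈ A, a < b) {z : K}
    (hg : ∀ B, g b B = z ^ B.card) {f : Fin (k + 1) → PowerSeries K} (hf : ∀ j, coeff 0 (f j) = 0)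
    (h : ∀ κ : Fin (k + 1) → ℕ, Antitone κ →
      fillSum SameRow StrictlyAbove RowBound g A (rowCells (fun _ => 0) κ) =
        (Matrix.of fun i j => coeff (κ i + (k + 1 - i)) (f j)).det)
    {ν : Fin (k + 1) → ℕ} (hν : Antitone ν) :
    fillSum SameRow StrictlyAbove RowBound g (insert b A) (rowCells (fun _ => 0) ν) =
      (Matrix.of fun i j => coeff (ν i + (k + 1 - i)) (ratio z 0 * f j)).det := by
  rw [fillSum_insert hA, sum_isStrip (fun c d h h' => ⟨h, h'⟩) (mem_interlacing_iff_isStrip hb hν),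
    ← sum_strip_add_staircase z hν f hf]
  refine Finset.sum_congr rfl fun κ hκ => ?_
  rw [h κ (antitone_of_mem_interlacing hν hκ), hg,
    card_rowCells_sdiff _ ((mem_interlacing_iff_isStrip hb hν κ).1 hκ).1,
    Finset.prod_pow_eq_pow_sum]

/-- A determinantal formula for the deformed symplectic characters. -/
theorem fillSum_symplectic (x x' : ℕ → K) (t : K) {k : ℕ} (hk : k ≤ n) {ν : Fin k → ℕ}
    (hν : Antitone ν) :
    fillSum SameRow StrictlyAbove RowBound (spWeight x x' t) (lettersBelow n k)
        (rowCells (fun _ => 0) ν) =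
      (Matrix.of fun i j : Fin k => coeff (ν i + (k - i)) (column x x' t k j)).det := by
  induction k with
  | zero =>
    have : rowCells (fun _ => 0) ν = ∅ := by simp [rowCells]
    rw [lettersBelow_zero, this, fillSum_empty_empty, Matrix.det_isEmpty]
  | succ k ih =>
    have hcol : ∀ j : Fin (k + 1), column x x' t (k + 1) j =
        ratio (x k) 0 * (ratio (t ^ 2 * x' k) 0 * (X * column x x' t k j)) := by
      intro j
      rw [column_succ _ _ _ (Nat.lt_succ_iff.1 j.2), invQuad]
      ring
    rw [lettersBelow_succ hk]
    simp only [hcol]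
    refine fillSum_insert_symplectic (k := k) rfl lt_unbarred
      (fun B => by simp [spWeight, unbarred, Letter.index]) (by simp) (fun κ hκ => ?_) hν
    refine fillSum_insert_symplectic (k := k) rfl lt_barred
      (fun B => by simp [spWeight, barred, Letter.index]) (by simp) (fun κ hκ => ?_) hκ
    -- The factor `X` absorbs the growth of the staircase from `k - i` to `k + 1 - i`.
    have hshift : (Matrix.of fun i j : Fin (k + 1) =>
        coeff (κ i + (k + 1 - i)) (X * column x x' t k j)) =
        Matrix.of fun i j : Fin (k + 1) => coeff (κ i + (k - i)) (column x x' t k j) := by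
      ext i j
      rw [Matrix.of_apply, Matrix.of_apply, show κ i + (k + 1 - i) = κ i + (k - i) + 1 by omega,
        coeff_succ_X_mul]
    rw [hshift]
    -- If row `k` is nonempty, both sides vanish: no letter of index below `k` is allowed there, and
    -- the last column of the determinant is zero.
    rcases Nat.eq_zero_or_pos (κ (Fin.last k)) with h | h
    · rw [rowCells_castSucc _ h, ih (Nat.le_of_succ_le hk)
        fun i j hij => hκ (Fin.castSucc_le_castSucc_iff.2 hij),
        det_column_castSucc x x' t (p := fun i => κ i + (k - i)) (by simp [h])]
      rfl
    · rw [det_column_eq_zero x x' t (p := fun i => κ i + (k - i)) fun i => by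
        have := hκ (Fin.le_last i)
        omega]
      refine fillSum_eq_zero (c := ((Fin.last k : Fin (k + 1)), 0)) (mk_mem_rowCells.2 (by simpa)) ?_
      intro a ha
      rw [mem_lettersBelow] at ha
      simp [RowBound, ha]

end symplectic

/-! ### Connected components of sets of boxes. -/

/-- The number of connected components of a set of boxes. -/
noncomputable def numComponents (B : Finset (ℕ × ℕ)) : ℕ :=
  Nat.card (boxGraph.induce (B : Set (ℕ × ℕ))).ConnectedComponent

/-- The number of rows that meet a set of boxes. -/
def numRows (B : Finset (ℕ × ℕ)) : ℕ := (B.image Prod.fst).card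

/-- The number of columns that meet a set of boxes. -/
def numCols (B : Finset (ℕ × ℕ)) : ℕ := (B.image Prod.snd).card

section connectivity

variable {B : Finset (ℕ × ℕ)}

theorem reachable_of_forall_mem {φ : ℕ → ℕ × ℕ} (hφ : ∀ l, boxGraph.Adj (φ l) (φ (l + 1))) {a b : ℕ}
    (hab : a ≤ b) (h : ∀ l, a ≤ l → l ≤ b → φ l ∈ B) :
    (boxGraph.induce (B : Set (ℕ × ℕ))).Reachable ⟨φ a, h a le_rfl hab⟩ ⟨φ b, h b hab le_rfl⟩ := by
  induction b, hab using Nat.le_induction with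
  | base => exact SimpleGraph.Reachable.refl _
  | succ b hab ih =>
    exact (ih fun l h₁ h₂ => h l h₁ (h₂.trans (Nat.le_succ b))).trans
      (SimpleGraph.Adj.reachable (hφ b))

theorem adj_row (i l : ℕ) : boxGraph.Adj (i, l) (i, l + 1) := Or.inl ⟨rfl, Or.inl rfl⟩

theorem adj_col (j l : ℕ) : boxGraph.Adj (l, j) (l + 1, j) := Or.inr ⟨rfl, Or.inl rfl⟩

theorem reachable_closed {V : Type*} {G : SimpleGraph V} {P : V → Prop}
    (h : ∀ u v, G.Adj u v → P u → P v) {u v : V} (huv : G.Reachable u v) (hu : P u) : P v := by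
  rw [SimpleGraph.reachable_iff_reflTransGen] at huv
  induction huv with
  | refl => exact hu
  | tail _ hadj ih => exact h _ _ hadj ih

theorem numComponents_le_card_image {f : ℕ × ℕ → ℕ}
    (h : ∀ c d : (B : Set (ℕ × ℕ)), f c = f d →
      (boxGraph.induce (B : Set (ℕ × ℕ))).Reachable c d) :
    numComponents B ≤ (B.image f).card := by
  rw [numComponents, ← Nat.card_eq_finsetCard]
  refine Nat.card_le_card_of_injective
    (fun C => ⟨f (Quot.out C).1, Finset.mem_image_of_mem f (Quot.out C).2⟩) fun C C' hC => ?_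
  have := h _ _ (congrArg Subtype.val hC)
  rw [← Quot.out_eq C, ← Quot.out_eq C']
  exact SimpleGraph.ConnectedComponent.sound this

theorem numComponents_le_numRows
    (h : ∀ i a b l, (i, a) ∈ B → (i, b) ∈ B → a ≤ l → l ≤ b → (i, l) ∈ B) :
    numComponents B ≤ numRows B := by
  refine numComponents_le_card_image ?_
  rintro ⟨⟨i, a⟩, ha⟩ ⟨⟨i', b⟩, hb⟩ (rfl : i = i')
  rcases le_total a b with hab | hab
  · exact reachable_of_forall_mem (φ := fun l => (i, l)) (adj_row i) hab
      fun l h₁ h₂ => h i a b l ha hb h₁ h₂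
  · exact (reachable_of_forall_mem (φ := fun l => (i, l)) (adj_row i) hab
      fun l h₁ h₂ => h i b a l hb ha h₁ h₂).symm

theorem numComponents_le_numCols
    (h : ∀ j a b l, (a, j) ∈ B → (b, j) ∈ B → a ≤ l → l ≤ b → (l, j) ∈ B) :
    numComponents B ≤ numCols B := by
  refine numComponents_le_card_image ?_
  rintro ⟨⟨a, j⟩, ha⟩ ⟨⟨b, j'⟩, hb⟩ (rfl : j = j')
  rcases le_total a b with hab | hab
  · exact reachable_of_forall_mem (φ := fun l => (l, j)) (adj_col j) hab
      fun l h₁ h₂ => h j a b l ha hb h₁ h₂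
  · exact (reachable_of_forall_mem (φ := fun l => (l, j)) (adj_col j) hab
      fun l h₁ h₂ => h j b a l hb ha h₁ h₂).symm

theorem numComponents_pos {c : ℕ × ℕ} (hc : c ∈ B) : 0 < numComponents B := by
  have : Finite (boxGraph.induce (B : Set (ℕ × ℕ))).ConnectedComponent := Quot.finite _
  have : Nonempty (boxGraph.induce (B : Set (ℕ × ℕ))).ConnectedComponent :=
    ⟨SimpleGraph.connectedComponentMk _ ⟨c, hc⟩⟩
  exact Nat.card_pos

end connectivity

/-! ### Rows, columns and components of a shifted strip. -/

section strips

variable {k : ℕ} {ν κ : Fin (k + 1) → ℕ}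

theorem mem_strip {c : ℕ × ℕ} : c ∈ rowCells id ν \ rowCells id κ ↔
    ∃ i : Fin (k + 1), c.1 = i ∧ i + κ i ≤ c.2 ∧ c.2 < i + ν i := by
  obtain ⟨a, j⟩ := c
  rw [Finset.mem_sdiff]
  constructor
  · rintro ⟨h₁, h₂⟩
    obtain ⟨i, hi, h₃, h₄⟩ := mem_rowCells.1 h₁
    dsimp only at hi
    subst hi
    rw [mk_mem_rowCells] at h₂
    exact ⟨i, rfl, by simp only [id] at *; omega, h₄⟩
  · rintro ⟨i, hi, h₁, h₂⟩
    dsimp only at hi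
    subst hi
    rw [mk_mem_rowCells, mk_mem_rowCells]
    simp only [id] at *
    omega

theorem mk_mem_strip {i : Fin (k + 1)} {j : ℕ} : ((i : ℕ), j) ∈ rowCells id ν \ rowCells id κ ↔
    i + κ i ≤ j ∧ j < i + ν i := by
  rw [mem_strip]
  constructor
  · rintro ⟨i', h, h'⟩
    rwa [Fin.ext h]
  · exact fun h => ⟨i, rfl, h⟩

theorem numRows_strip : numRows (rowCells id ν \ rowCells id κ) =
    (Finset.univ.filter fun i => κ i < ν i).card := by
  rw [numRows, ← Finset.card_map Fin.valEmbedding]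
  congr 1
  ext a
  simp only [Finset.mem_image, Finset.mem_map, Finset.mem_filter, Finset.mem_univ, true_and,
    Fin.valEmbedding_apply, mem_strip]
  constructor
  · rintro ⟨c, ⟨i, hi, h₁, h₂⟩, rfl⟩
    exact ⟨i, by omega, hi.symm⟩
  · rintro ⟨i, hi, rfl⟩
    exact ⟨(i, i + κ i), ⟨i, rfl, le_rfl, by omega⟩, rfl⟩

theorem nextRow_eq {i : Fin (k + 1)} {a : ℕ} (ha : a = i + 1) (h : a < k + 1) :
    nextRow ν i = ν ⟨a, h⟩ := by
  subst ha
  rw [nextRow, dif_pos h]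

theorem pos_of_lt_last (hκ : StrictAnti κ) {i : Fin (k + 1)} (h : (i : ℕ) + 1 < k + 1) :
    0 < κ i :=
  (Nat.zero_le _).trans_lt (hκ (a := i) (b := ⟨i + 1, h⟩) (Fin.lt_def.2 (by simp)))

theorem lt_of_nextRow_ne_zero {i : Fin (k + 1)} (h : nextRow ν i ≠ 0) : (i : ℕ) + 1 < k + 1 := by
  rw [nextRow] at h
  split_ifs at h with h'
  · exact h'
  · exact absurd rfl h

/-- The rows of a strip that are connected to the next row. -/
def joinedRows (ν κ : Fin (k + 1) → ℕ) : Finset (Fin (k + 1)) :=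
  Finset.univ.filter fun i => κ i < ν i ∧ κ i = nextRow ν i ∧ κ i ≠ 0

/-- The last rows of the components of a strip. -/
def bottomRows (ν κ : Fin (k + 1) → ℕ) : Finset (Fin (k + 1)) :=
  Finset.univ.filter fun i => κ i < ν i ∧ ¬ (κ i = nextRow ν i ∧ κ i ≠ 0)

theorem numRows_strip_eq_add : numRows (rowCells id ν \ rowCells id κ) =
    (joinedRows ν κ).card + (bottomRows ν κ).card := by
  rw [numRows_strip, ← Finset.card_filter_add_card_filter_not
    (fun i => κ i = nextRow ν i ∧ κ i ≠ 0), Finset.filter_filter, Finset.filter_filter]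
  rfl

/-- Each strip row is connected, and row `i` touches row `i + 1` exactly when `κ i = nextRow ν i` is
nonzero. Sending a component to its lowest row is therefore a bijection. The nonzero condition
excludes the last row, where `nextRow` is zero by convention. -/
theorem numComponents_strip (h : κ ∈ interlacing ν) (hκ : StrictAnti κ) :
    numComponents (rowCells id ν \ rowCells id κ) = (bottomRows ν κ).card := by
  rw [mem_interlacing] at h
  set B := rowCells id ν \ rowCells id κ with hB
  have hleft : ∀ i : Fin (k + 1), κ i < ν i → ((i : ℕ), i + κ i) ∈ (B : Set (ℕ × ℕ)) :=
    fun i hi => Finset.mem_coe.2 (mk_mem_strip.2 (by omega))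
  have hrow : ∀ (i : Fin (k + 1)) (hi : κ i < ν i) (c : (B : Set (ℕ × ℕ))), c.1.1 = i →
      (boxGraph.induce (B : Set (ℕ × ℕ))).Reachable c ⟨_, hleft i hi⟩ := by
    rintro i hi ⟨⟨a, j⟩, hc⟩ hci
    dsimp only at hci
    subst hci
    have hj := mk_mem_strip.1 (Finset.mem_coe.1 hc)
    exact (reachable_of_forall_mem (φ := fun l => ((i : ℕ), l)) (adj_row i) hj.1
      fun l h₁ h₂ => mk_mem_strip.2 (by omega)).symm
  rw [numComponents, ← Nat.card_eq_finsetCard]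
  symm
  refine Nat.card_eq_of_bijective (fun i : bottomRows ν κ =>
    SimpleGraph.connectedComponentMk _ ⟨_, hleft i.1 (Finset.mem_filter.1 i.2).2.1⟩) ⟨?_, ?_⟩
  · have key : ∀ i i' : bottomRows ν κ, i.1 < i'.1 →
        ¬ (boxGraph.induce (B : Set (ℕ × ℕ))).Reachable
          ⟨_, hleft i.1 (Finset.mem_filter.1 i.2).2.1⟩
          ⟨_, hleft i'.1 (Finset.mem_filter.1 i'.2).2.1⟩ := by
      rintro ⟨i, hi⟩ ⟨i', hi'⟩ hlt hr
      have hi := (Finset.mem_filter.1 hi).2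
      refine absurd (reachable_closed (P := fun c : (B : Set (ℕ × ℕ)) => c.1.1 ≤ i) ?_ hr le_rfl)
        (not_le.2 hlt)
      rintro ⟨⟨a, j⟩, hc⟩ ⟨⟨a', j'⟩, hc'⟩ hadj hle
      dsimp only at hle ⊢
      by_contra hlt
      have hadj : boxGraph.Adj (a, j) (a', j') := hadj
      simp only [boxGraph] at hadj
      -- An edge leaving the rows up to `i` is vertical and goes from row `i` to row `i + 1`; this
      -- forces `κ i = nextRow ν i`, which a bottom row excludes.
      have haa : a = i ∧ a' = i + 1 ∧ j = j' := by omega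
      obtain ⟨rfl, rfl, rfl⟩ := haa
      have h₁ := mk_mem_strip.1 (Finset.mem_coe.1 hc)
      obtain ⟨l, hl, h₂⟩ := mem_strip.1 (Finset.mem_coe.1 hc')
      dsimp only at hl h₂
      have hi₁ : (i : ℕ) + 1 < k + 1 := hl ▸ l.2
      have hnext : nextRow ν i = ν l := nextRow_eq hl.symm l.2
      have := pos_of_lt_last hκ hi₁
      have := (h i).1
      exact hi.2 ⟨by omega, by omega⟩
    intro i i' hii
    have hr := SimpleGraph.ConnectedComponent.exact hii
    rcases lt_trichotomy i.1 i'.1 with hlt | heq | hlt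
    · exact absurd hr (key i i' hlt)
    · exact Subtype.ext heq
    · exact absurd hr.symm (key i' i hlt)
  -- Every strip row is connected to a bottom row, by descending as long as the current row is
  -- joined to the next.
  · have key : ∀ (d : ℕ) (i : Fin (k + 1)), (i : ℕ) + d = k → ∀ hi : κ i < ν i,
        ∃ i' : bottomRows ν κ, (boxGraph.induce (B : Set (ℕ × ℕ))).Reachable ⟨_, hleft i hi⟩
          ⟨_, hleft i'.1 (Finset.mem_filter.1 i'.2).2.1⟩ := by
      intro d
      induction d with
      | zero =>
        intro i hid hi
        refine ⟨⟨i, Finset.mem_filter.2 ⟨Finset.mem_univ _, hi, ?_⟩⟩, SimpleGraph.Reachable.refl _⟩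
        rintro ⟨h₁, h₂⟩
        have := lt_of_nextRow_ne_zero (h₁ ▸ h₂)
        omega
      | succ d ih =>
        intro i hid hi
        by_cases hb : κ i = nextRow ν i ∧ κ i ≠ 0
        · have hi₁ : (i : ℕ) + 1 < k + 1 := by omega
          have hnext := nextRow_eq (ν := ν) rfl hi₁
          have hlt : κ ⟨i + 1, hi₁⟩ < κ i := hκ (Fin.lt_def.2 (by simp))
          have hi' : κ ⟨i + 1, hi₁⟩ < ν ⟨i + 1, hi₁⟩ := by omega
          obtain ⟨i', hr⟩ := ih ⟨i + 1, hi₁⟩ (by simp only; omega) hi'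
          have hmem : (((⟨i + 1, hi₁⟩ : Fin (k + 1)) : ℕ), i + κ i) ∈ (B : Set (ℕ × ℕ)) :=
            Finset.mem_coe.2 (mk_mem_strip.2 (by simp only; omega))
          have hadj : (boxGraph.induce (B : Set (ℕ × ℕ))).Adj ⟨_, hleft i hi⟩ ⟨_, hmem⟩ :=
            adj_col _ _
          exact ⟨i', hadj.reachable.trans ((hrow _ hi' ⟨_, hmem⟩ rfl).trans hr)⟩
        · exact ⟨⟨i, Finset.mem_filter.2 ⟨Finset.mem_univ _, hi, hb⟩⟩, SimpleGraph.Reachable.refl _⟩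
    intro C
    induction C using SimpleGraph.ConnectedComponent.ind with
    | _ c =>
      obtain ⟨i, hi, h₁, h₂⟩ := mem_strip.1 (Finset.mem_coe.1 c.2)
      have hlt : κ i < ν i := by omega
      obtain ⟨i', hr⟩ := key (k - i) i (by omega) hlt
      exact ⟨i', SimpleGraph.ConnectedComponent.sound ((hrow i hlt c hi).trans hr).symm⟩

/-- A joined row shares exactly one column, that of its leftmost box, with the next row. Assigning
this column to the lower row makes the column set a disjoint union of intervals. -/
theorem numCols_strip (h : κ ∈ interlacing ν) (hκ : StrictAnti κ) (hν : StrictAnti ν) :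
    numCols (rowCells id ν \ rowCells id κ) + (joinedRows ν κ).card = ∑ i, (ν i - κ i) := by
  rw [mem_interlacing] at h
  set e : Fin (k + 1) → ℕ := fun i => if κ i < ν i ∧ κ i = nextRow ν i ∧ κ i ≠ 0 then 1 else 0
    with he
  have hle : ∀ i, e i ≤ 1 ∧ (e i = 1 → κ i < ν i ∧ κ i = nextRow ν i ∧ κ i ≠ 0) := by
    intro i
    simp only [he]
    split_ifs with h
    · exact ⟨le_rfl, fun _ => h⟩
    · simp
  have hcols : (rowCells id ν \ rowCells id κ).image Prod.snd =
      Finset.univ.biUnion fun i : Fin (k + 1) => Finset.Ico (i + κ i + e i) (i + ν i) := by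
    ext j
    simp only [Finset.mem_image, Finset.mem_biUnion, Finset.mem_univ, true_and, Finset.mem_Ico]
    constructor
    · rintro ⟨c, hc, rfl⟩
      obtain ⟨i, hi, h₁⟩ := mem_strip.1 hc
      generalize c.2 = j at h₁
      clear hi hc
      -- A column may be passed down through several joined rows, hence the induction.
      obtain ⟨d, hd⟩ : ∃ d, d + (i : ℕ) = k := ⟨k - i, by omega⟩
      induction d generalizing i with
      | zero =>
        refine ⟨i, ?_⟩
        have := hle i
        rcases Nat.le_one_iff_eq_zero_or_eq_one.1 this.1 with h₀ | h₀
        · omega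
        · have := this.2 h₀
          have := lt_of_nextRow_ne_zero (ν := ν) (i := i) (by omega)
          omega
      | succ d ih =>
        by_cases hj : i + κ i + e i ≤ j
        · exact ⟨i, hj, h₁.2⟩
        · have hi₁ : (i : ℕ) + 1 < k + 1 := by omega
          have := (hle i).1
          have h₂ := (hle i).2 (by omega)
          have h₃ := nextRow_eq (ν := ν) rfl hi₁
          have h₄ : κ ⟨i + 1, hi₁⟩ < κ i := hκ (Fin.lt_def.2 (by simp))
          exact ih ⟨i + 1, hi₁⟩ (by simp only; omega) (by simp only; omega)
    · rintro ⟨i, h₁, h₂⟩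
      exact ⟨(i, j), mk_mem_strip.2 (by omega), rfl⟩
  rw [numCols, hcols, Finset.card_biUnion]
  · have hj : (joinedRows ν κ).card = ∑ i, e i := by
      rw [joinedRows, Finset.card_filter]
    rw [hj, ← Finset.sum_add_distrib]
    refine Finset.sum_congr rfl fun i _ => ?_
    rw [Nat.card_Ico]
    have := hle i
    have := (h i).2
    rcases Nat.le_one_iff_eq_zero_or_eq_one.1 (hle i).1 with h₀ | h₀
    · omega
    · have := (hle i).2 h₀
      omega
  · have key : ∀ i i' : Fin (k + 1), i < i' → Disjoint (Finset.Ico (i + κ i + e i) (i + ν i))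
        (Finset.Ico (i' + κ i' + e i') (i' + ν i')) := by
      intro i i' hlt
      rw [Finset.disjoint_left]
      intro j hj hj'
      rw [Finset.mem_Ico] at hj hj'
      have hlt' := Fin.lt_def.1 hlt
      have hi₁ : (i : ℕ) + 1 < k + 1 := by omega
      have h₁ := add_sub_le_of_strictAnti hν (i := ⟨i + 1, hi₁⟩) (j := i') (Fin.le_def.2 hlt')
      have h₃ := nextRow_eq (ν := ν) rfl hi₁
      have h₄ := (h i).1
      simp only at h₁
      have h₅ := pos_of_lt_last hκ hi₁
      -- An overlap with a lower row would force `κ i = nextRow ν i`, so row `i` would be joined and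
      -- its shared column already omitted.
      have h₆ : e i = 1 := by
        simp only [he]
        rw [if_pos]
        omega
      omega
    intro i _ i' _ hne
    rcases lt_or_gt_of_ne hne with hlt | hlt
    · exact key i i' hlt
    · exact (key i' i hlt).symm

end strips

/-! ### Strip weights and the determinant for shifted tableaux. -/

section weights

variable {k : ℕ} {ν κ : Fin (k + 1) → ℕ}

/-- The rows of a strip in which the removed part ends strictly above the next row. -/
def freeRows (ν κ : Fin (k + 1) → ℕ) : Finset (Fin (k + 1)) :=
  Finset.univ.filter fun i => κ i < ν i ∧ κ i ≠ nextRow ν i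

/-- The only bottom row that is not free is the last row when it is emptied, that is, when the strip
contains the main diagonal box `(k, k)`. The component of that box supplies the `1` subtracted in
`shWeight`. -/
theorem card_bottomRows (hκ : StrictAnti κ) : (bottomRows ν κ).card =
    (freeRows ν κ).card + if (k, k) ∈ rowCells id ν \ rowCells id κ then 1 else 0 := by
  rw [← Finset.card_filter_add_card_filter_not (s := bottomRows ν κ) (fun i => κ i ≠ nextRow ν i)]
  congr 1
  · rw [bottomRows, freeRows, Finset.filter_filter]
    congr 1
    ext i
    simp only [Finset.mem_filter, Finset.mem_univ, true_and]
    tauto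
  · have hmem : (k, k) ∈ rowCells id ν \ rowCells id κ ↔
        κ (Fin.last k) = 0 ∧ 0 < ν (Fin.last k) := by
      have := mk_mem_strip (ν := ν) (κ := κ) (i := Fin.last k) (j := k)
      rw [Fin.val_last] at this
      rw [this]
      omega
    have hfilter : (bottomRows ν κ).filter (fun i => ¬ κ i ≠ nextRow ν i) =
        if (k, k) ∈ rowCells id ν \ rowCells id κ then {Fin.last k} else ∅ := by
      simp only [hmem]
      ext i
      simp only [bottomRows, Finset.mem_filter, Finset.mem_univ, true_and, not_not]
      have hlast : nextRow ν (Fin.last k) = 0 := by simp [nextRow]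
      have hi : κ i = 0 → i = Fin.last k := by
        intro h₀
        by_contra hne
        have hlt : i < Fin.last k := lt_of_le_of_ne (Fin.le_last i) hne
        have := hκ hlt
        omega
      split_ifs with h
      · rw [Finset.mem_singleton]
        constructor
        · rintro ⟨⟨h₁, h₂⟩, h₃⟩
          exact hi (by tauto)
        · rintro rfl
          exact ⟨⟨by omega, fun h' => h'.2 h.1⟩, by omega⟩
      · simp only [Finset.notMem_empty, iff_false]
        rintro ⟨⟨h₁, h₂⟩, h₃⟩
        have h₀ : κ i = 0 := by tauto
        obtain rfl := hi h₀
        exact h ⟨h₀, by omega⟩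
    rw [hfilter]
    split_ifs <;> simp

variable {K : Type*} [CommRing K] {n : ℕ}

/-- The contribution of the boxes with entry `a` to the weight of a shifted tableau. -/
noncomputable def shWeight (x x' : ℕ → K) (t : K) (a : Letter n) (B : Finset (ℕ × ℕ)) : K :=
  (if (ofLex a).2 then t ^ (numRows B - numComponents B) * x a.index ^ B.card
    else t ^ (numCols B - numComponents B + B.card) * x' a.index ^ B.card) *
  (1 + t) ^ (numComponents B - if ((a.index : ℕ), (a.index : ℕ)) ∈ B then 1 else 0)

theorem pow_card_filter {ι : Type*} [Fintype ι] (p : ι → Prop) [DecidablePred p] (t : K) :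
    t ^ (Finset.univ.filter p).card = ∏ i, if p i then t else 1 := by
  rw [← Finset.prod_filter, Finset.prod_const]

/-- Rows minus components counts joined rows, each giving a factor $t$; each free row gives $1+t$; a
row emptied through the main diagonal gives neither. This dictates $z=x_k$, $y=tx_k$, $u=x_k$. -/
theorem shWeight_unbarred_strip (x x' : ℕ → K) (t : K) (hk : k < n) (h : κ ∈ interlacing ν)
    (hκ : StrictAnti κ) :
    shWeight x x' t (unbarred (⟨k, hk⟩ : Fin n)) (rowCells id ν \ rowCells id κ) =
      ∏ i, stripWeight (x k) (t * x k) (x k) (ν i) (nextRow ν i) (κ i) := by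
  have hle : κ ≤ ν := fun i => (mem_interlacing.1 h i).2
  have h₁ : numRows (rowCells id ν \ rowCells id κ) - numComponents (rowCells id ν \ rowCells id κ) =
      (joinedRows ν κ).card := by
    rw [numRows_strip_eq_add, numComponents_strip h hκ, Nat.add_sub_cancel]
  have h₂ : (numComponents (rowCells id ν \ rowCells id κ) -
      if (k, k) ∈ rowCells id ν \ rowCells id κ then 1 else 0) = (freeRows ν κ).card := by
    rw [numComponents_strip h hκ, card_bottomRows hκ, Nat.add_sub_cancel]
  have : shWeight x x' t (unbarred (⟨k, hk⟩ : Fin n)) (rowCells id ν \ rowCells id κ) =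
      t ^ (joinedRows ν κ).card * x k ^ (∑ i, (ν i - κ i)) * (1 + t) ^ (freeRows ν κ).card := by
    rw [← h₁, ← h₂, ← card_rowCells_sdiff id hle]
    rfl
  rw [this, joinedRows, freeRows, pow_card_filter, pow_card_filter, ← Finset.prod_pow_eq_pow_sum,
    ← Finset.prod_mul_distrib, ← Finset.prod_mul_distrib]
  refine Finset.prod_congr rfl fun i _ => ?_
  have hi := mem_interlacing.1 h i
  rcases hi.2.eq_or_lt with heq | hlt
  · simp [stripWeight, heq]
  · obtain ⟨d, hd⟩ := Nat.exists_eq_add_of_lt hlt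
    have hd' : ν i - κ i = d + 1 := by omega
    simp only [stripWeight, if_neg hlt.ne, hlt, hd', true_and, Nat.add_sub_cancel]
    by_cases hb : κ i = nextRow ν i
    · by_cases h₀ : κ i = 0
      · simp [← hb, h₀, pow_succ']
      · simp [← hb, h₀]
        ring
    · simp [hb]
      ring

theorem shWeight_barred_strip (x x' : ℕ → K) (t : K) (hk : k < n) (h : κ ∈ interlacing ν)
    (hκ : StrictAnti κ) (hν : StrictAnti ν) :
    shWeight x x' t (barred (⟨k, hk⟩ : Fin n)) (rowCells id ν \ rowCells id κ) =
      ∏ i, stripWeight (t ^ 2 * x' k) (t * x' k) (t * x' k) (ν i) (nextRow ν i) (κ i) := by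
  have hle : κ ≤ ν := fun i => (mem_interlacing.1 h i).2
  have h₂ : (numComponents (rowCells id ν \ rowCells id κ) -
      if (k, k) ∈ rowCells id ν \ rowCells id κ then 1 else 0) = (freeRows ν κ).card := by
    rw [numComponents_strip h hκ, card_bottomRows hκ, Nat.add_sub_cancel]
  -- Columns plus joined rows is the size of the strip, and components plus joined rows is the
  -- number of rows. So the exponent of $t$ is twice the size minus the number of rows: each
  -- nonempty row contributes one $tx_k^{-1}$ and otherwise factors $t^2x_k^{-1}$.
  have h₁ : numCols (rowCells id ν \ rowCells id κ) - numComponents (rowCells id ν \ rowCells id κ) +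
      ∑ i, (ν i - κ i) = ∑ i, (2 * (ν i - κ i) - 1) := by
    have hc := numCols_strip h hκ hν
    have hr := numRows_strip_eq_add (ν := ν) (κ := κ)
    rw [numRows_strip, Finset.card_filter] at hr
    have hs : ∑ i, (2 * (ν i - κ i) - 1) + ∑ i, (if κ i < ν i then 1 else 0) =
        ∑ i, (ν i - κ i) + ∑ i, (ν i - κ i) := by
      rw [← Finset.sum_add_distrib, ← Finset.sum_add_distrib]
      refine Finset.sum_congr rfl fun i _ => ?_
      split_ifs <;> omega
    have hle' : ∑ i, (if κ i < ν i then 1 else 0) ≤ ∑ i, (ν i - κ i) := by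
      refine Finset.sum_le_sum fun i _ => ?_
      split_ifs <;> omega
    rw [numComponents_strip h hκ]
    omega
  have : shWeight x x' t (barred (⟨k, hk⟩ : Fin n)) (rowCells id ν \ rowCells id κ) =
      t ^ (∑ i, (2 * (ν i - κ i) - 1)) * x' k ^ (∑ i, (ν i - κ i)) *
        (1 + t) ^ (freeRows ν κ).card := by
    rw [← h₁, ← h₂, ← card_rowCells_sdiff id hle]
    rfl
  rw [this, freeRows, pow_card_filter, ← Finset.prod_pow_eq_pow_sum, ← Finset.prod_pow_eq_pow_sum,
    ← Finset.prod_mul_distrib, ← Finset.prod_mul_distrib]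
  refine Finset.prod_congr rfl fun i _ => ?_
  have hi := mem_interlacing.1 h i
  rcases hi.2.eq_or_lt with heq | hlt
  · simp [stripWeight, heq]
  · obtain ⟨d, hd⟩ := Nat.exists_eq_add_of_lt hlt
    have hd' : ν i - κ i = d + 1 := by omega
    have hd₂ : 2 * (d + 1) - 1 = 2 * d + 1 := by omega
    simp only [stripWeight, if_neg hlt.ne, hlt, hd', true_and, Nat.add_sub_cancel, hd₂, mul_pow,
      ← pow_mul, pow_succ]
    by_cases hb : κ i = nextRow ν i
    · simp [← hb]
      ring
    · simp [hb]
      ring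

theorem fillSum_insert_shifted {g : Letter n → Finset (ℕ × ℕ) → K} {A : Finset (Letter n)}
    {b : Letter n} (hb : (b.index : ℕ) = k) (hA : ∀ a ∈ A, a < b) {z y u : K}
    (hν : StrictAnti ν)
    (hg : ∀ κ ∈ interlacing ν, StrictAnti κ → g b (rowCells id ν \ rowCells id κ) =
      ∏ i, stripWeight z y u (ν i) (nextRow ν i) (κ i))
    {c : K} {f : Fin (k + 1) → ℕ → K}
    (h : ∀ κ ∈ interlacing ν, StrictAnti κ →
      fillSum SameRowOrCol SameDiag DiagEntry g A (rowCells id κ) =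
        c * (Matrix.of fun i j => f j (κ i)).det) :
    fillSum SameRowOrCol SameDiag DiagEntry g (insert b A) (rowCells id ν) =
      c * (Matrix.of fun i j => stripSum z y u (f j) (ν i)).det := by
  classical
  rw [fillSum_insert hA, sum_isStrip (R₁ := SameRowOrCol) (fun c d h h' => Or.inl ⟨h, h'⟩)
    (mem_interlacing_strictAnti_iff_isStrip hb hν), ← sum_interlacing_stripWeight z y u hν f,
    Finset.mul_sum]
  refine Finset.sum_congr (Finset.filter_congr_decidable ..) fun κ hκ => ?_
  obtain ⟨hκ, hκ'⟩ := Finset.mem_filter.1 hκ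
  rw [h κ hκ hκ', hg κ hκ hκ']
  ring

/-- The deformed Weyl denominator. -/
def denominator (x x' : ℕ → K) (t : K) (k : ℕ) : K :=
  ∏ i ∈ Finset.range k, ((x i + t * x' i) * ∏ j ∈ Finset.range i, factor x x' t j i)

/-- A determinantal formula for the generating functions of shifted tableaux. -/
theorem fillSum_shifted {x x' : ℕ → K} (hx : ∀ i, x i * x' i = 1) (t : K) {k : ℕ} (hk : k ≤ n)
    {ν : Fin k → ℕ} (hν : StrictAnti ν) (hpos : ∀ i, 0 < ν i) :
    fillSum SameRowOrCol SameDiag DiagEntry (shWeight x x' t) (lettersBelow n k) (rowCells id ν) =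
      denominator x x' t k *
        (Matrix.of fun i j : Fin k => coeff (ν i) (column x x' t k j)).det := by
  induction k with
  | zero =>
    have : rowCells id ν = ∅ := by simp [rowCells]
    rw [lettersBelow_zero, this, fillSum_empty_empty, Matrix.det_isEmpty]
    simp [denominator]
  | succ k ih =>
    have hdet := det_stripSum_column t hx (ν := ν) fun i => (hpos i).ne'
    rw [lettersBelow_succ hk, denominator, Finset.prod_range_succ, ← denominator, mul_assoc,
      ← hdet]
    refine fillSum_insert_shifted (k := k) rfl lt_unbarred hν
      (fun κ hκ hκ' => shWeight_unbarred_strip x x' t hk hκ hκ') fun κ _ hκ => ?_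
    refine fillSum_insert_shifted (k := k) rfl lt_barred hκ
      (fun κ' h h' => shWeight_barred_strip x x' t hk h h' hκ) fun κ' _ hκ' => ?_
    -- If row `k` is nonempty, its main diagonal box admits no letter of index below `k`, and the
    -- determinant vanishes as well.
    rcases Nat.eq_zero_or_pos (κ' (Fin.last k)) with h | h
    · rw [rowCells_castSucc _ h, ih (Nat.le_of_succ_le hk)
        (fun i j hij => hκ' (Fin.castSucc_lt_castSucc_iff.2 hij)) fun i =>
          (Nat.zero_le _).trans_lt (hκ' (Fin.castSucc_lt_last i)), det_column_castSucc x x' t h]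
    · rw [det_column_eq_zero x x' t fun i => by
        have := hκ'.antitone (Fin.le_last i)
        omega, mul_zero]
      refine fillSum_eq_zero (c := ((Fin.last k : Fin (k + 1)), k))
        (mk_mem_rowCells.2 (by simpa)) ?_
      intro a ha
      rw [mem_lettersBelow] at ha
      simp [DiagEntry, ha.ne]

end weights

/-! ### Translation between tableau statistics and products of letter weights. -/

section statistics

variable {n : ℕ}

theorem prod_letter {M : Type*} [CommMonoid M] (f : Letter n → M) :
    ∏ a, f a = ∏ k : Fin n, f (unbarred k) * f (barred k) := by
  rw [← Equiv.prod_comp toLex f, Fintype.prod_prod_type]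
  simp only [Fintype.prod_bool]
  rfl

theorem sum_letter {M : Type*} [AddCommMonoid M] (f : Letter n → M) :
    ∑ a, f a = ∑ k : Fin n, (f (unbarred k) + f (barred k)) := by
  rw [← Equiv.sum_comp toLex f, Fintype.sum_prod_type]
  simp only [Fintype.sum_bool]
  rfl

variable {D : Finset (ℕ × ℕ)} (T : Filling n D) (a : Letter n)

theorem card_cellsOf : (cellsOf T a).card = count T a := Finset.card_map _

theorem numRows_cellsOf : numRows (cellsOf T a) = row T a := by
  rw [numRows, cellsOf, row, Finset.map_eq_image, Finset.image_image]
  rfl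

theorem numCols_cellsOf : numCols (cellsOf T a) = col T a := by
  rw [numCols, cellsOf, col, Finset.map_eq_image, Finset.image_image]
  rfl

theorem numComponents_cellsOf : numComponents (cellsOf T a) = con T a := by
  have : {c : ℕ × ℕ | ∃ h : c ∈ D, T ⟨c, h⟩ = a} = (cellsOf T a : Set (ℕ × ℕ)) := by
    ext c
    rw [Finset.mem_coe, mem_cellsOf]
    rfl
  rw [con, this, numComponents]

end statistics

/-- The extension of a finite sequence by ones. -/
def extend {K : Type*} [One K] {n : ℕ} (x : Fin n → K) (i : ℕ) : K :=
  if h : i < n then x ⟨i, h⟩ else 1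

theorem extend_val {K : Type*} [One K] {n : ℕ} (x : Fin n → K) (i : Fin n) : extend x i = x i := by
  simp [extend]

theorem cells_eq_rowCells {n : ℕ} {lam : YoungDiagram} (hlam : lam.colLen 0 ≤ n) :
    lam.cells = rowCells (fun _ => 0) fun i : Fin n => lam.rowLen i := by
  ext ⟨i, j⟩
  rw [mem_rowCells, YoungDiagram.mem_cells]
  constructor
  · intro h
    have h₁ := YoungDiagram.mem_iff_lt_colLen.1 h
    have h₂ := lam.colLen_anti 0 j (Nat.zero_le _)
    have h₃ := YoungDiagram.mem_iff_lt_rowLen.1 h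
    exact ⟨⟨i, by omega⟩, rfl, Nat.zero_le _, by simpa using h₃⟩
  · rintro ⟨i', h, -, h'⟩
    dsimp only at h h'
    subst h
    rw [zero_add] at h'
    exact YoungDiagram.mem_iff_lt_rowLen.2 h'

section field

variable {K : Type*} [Field K] {n : ℕ} {x : Fin n → K}

theorem spChar_eq_fillSum (hx : ∀ i, x i ≠ 0) (t : K) (lam : YoungDiagram) :
    spChar lam x t = fillSum (n := n) SameRow StrictlyAbove RowBound
      (spWeight (extend x) (fun i => (extend x i)⁻¹) t) Finset.univ lam.cells := by
  classical
  rw [spChar, fillSum, symplecticTableaux]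
  refine Finset.sum_congr ?_ fun T _ => ?_
  · ext T
    simp only [Finset.mem_filter, Finset.mem_univ, true_and, implies_true, and_true]
    constructor
    · exact fun h => ⟨fun c d hcd => h.row_weak c d hcd.1 hcd.2,
        fun c d hcd => h.col_strict c d hcd.1 hcd.2, h.row_le⟩
    · exact fun h => ⟨fun c d h₁ h₂ => h.weak c d ⟨h₁, h₂⟩, fun c d h₁ h₂ => h.strict c d ⟨h₁, h₂⟩,
        h.entry⟩
  · rw [prod_letter, bar, Finset.mul_sum, ← Finset.prod_pow_eq_pow_sum, ← Finset.prod_mul_distrib]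
    refine Finset.prod_congr rfl fun k _ => ?_
    simp only [spWeight, card_cellsOf, unbarred, barred, Letter.index, ofLex_toLex, extend_val,
      if_true, Bool.false_eq_true, if_false, wgt]
    rw [zpow_sub₀ (hx k), zpow_natCast, zpow_natCast, mul_pow, ← pow_mul, inv_pow, div_eq_mul_inv]
    ring

theorem mem_cellsOf_of_row {μ : Fin n → ℕ} {S : Filling n (shiftedCells μ)}
    (hS : IsShiftedSymplectic S) (e : Letter n) (i a b l : ℕ) (ha : (i, a) ∈ cellsOf S e)
    (hb : (i, b) ∈ cellsOf S e) (hal : a ≤ l) (hlb : l ≤ b) : (i, l) ∈ cellsOf S e := by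
  rw [mem_cellsOf] at *
  obtain ⟨ha, ha'⟩ := ha
  obtain ⟨hb, hb'⟩ := hb
  have hl : (i, l) ∈ shiftedCells μ := by
    obtain ⟨i₁, h₁, h₁'⟩ := mem_rowCells (o := id).1 ha
    obtain ⟨i₂, h₂, h₂'⟩ := mem_rowCells (o := id).1 hb
    refine mem_rowCells (o := id).2 ⟨i₁, h₁, ?_⟩
    obtain rfl : i₁ = i₂ := Fin.ext (h₁.symm.trans h₂)
    dsimp only [id] at *
    omega
  exact ⟨hl, le_antisymm (hb' ▸ hS.row_weak ⟨(i, l), hl⟩ ⟨(i, b), hb⟩ rfl hlb)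
    (ha' ▸ hS.row_weak ⟨(i, a), ha⟩ ⟨(i, l), hl⟩ rfl hal)⟩

theorem mem_cellsOf_of_col {μ : Fin n → ℕ} (hμ : StrictAnti μ) {S : Filling n (shiftedCells μ)}
    (hS : IsShiftedSymplectic S) (e : Letter n) (j a b l : ℕ) (ha : (a, j) ∈ cellsOf S e)
    (hb : (b, j) ∈ cellsOf S e) (hal : a ≤ l) (hlb : l ≤ b) : (l, j) ∈ cellsOf S e := by
  rw [mem_cellsOf] at *
  obtain ⟨ha, ha'⟩ := ha
  obtain ⟨hb, hb'⟩ := hb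
  have hl : (l, j) ∈ shiftedCells μ := by
    obtain ⟨i, h, h'⟩ := mem_rowCells (o := id).1 hb
    dsimp only [id] at *
    have := i.2
    have h₁ := add_sub_le_of_strictAnti hμ (i := ⟨l, by omega⟩) (j := i)
      (Fin.le_def.2 (by simp; omega))
    refine mem_rowCells (o := id).2 ⟨⟨l, by omega⟩, rfl, ?_⟩
    dsimp only [id] at *
    omega
  exact ⟨hl, le_antisymm (hb' ▸ hS.col_weak ⟨(l, j), hl⟩ ⟨(b, j), hb⟩ rfl hlb)
    (ha' ▸ hS.col_weak ⟨(a, j), ha⟩ ⟨(l, j), hl⟩ rfl hal)⟩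

/-- Intersections of the set of boxes of a letter with rows and columns are intervals, so `con` is
at most `row` and at most `col`. Hence the truncated subtractions in `shWeight` are exact and all
integer exponents of `t` and `1 + t` are natural numbers. -/
theorem weight_eq_prod_shWeight (hx : ∀ i, x i ≠ 0) (t : K) {μ : Fin n → ℕ} (hμ : StrictAnti μ)
    (hpos : ∀ i, 0 < μ i) {S : Filling n (shiftedCells μ)} (hS : IsShiftedSymplectic S) :
    t ^ (var S + (bar S : ℤ)) * (1 + t) ^ ((str S : ℤ) - (n : ℤ)) * ∏ k : Fin n, x k ^ wgt S k =
      ∏ a, shWeight (extend x) (fun i => (extend x i)⁻¹) t a (cellsOf S a) := by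
  have hrow : ∀ a, con S a ≤ row S a := fun a => by
    rw [← numComponents_cellsOf, ← numRows_cellsOf]
    exact numComponents_le_numRows (mem_cellsOf_of_row hS a)
  have hcol : ∀ a, con S a ≤ col S a := fun a => by
    rw [← numComponents_cellsOf, ← numCols_cellsOf]
    exact numComponents_le_numCols (mem_cellsOf_of_col hμ hS a)
  -- This marks the letters occurring at their own main diagonal position. Exactly one of
  -- $k,\overline k$ is marked, which distributes the $-n$ in the exponent of $1+t$ over the
  -- letters.
  obtain ⟨δ, hδ⟩ : ∃ δ : Letter n → ℕ, ∀ a, δ a =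
    if ((a.index : ℕ), (a.index : ℕ)) ∈ cellsOf S a then 1 else 0 := ⟨_, fun _ => rfl⟩
  have hδ_le : ∀ a, δ a ≤ con S a := fun a => by
    rw [hδ]
    split_ifs with h
    · rw [← numComponents_cellsOf]
      exact numComponents_pos h
    · exact Nat.zero_le _
  have hδ_add : ∀ k : Fin n, δ (unbarred k) + δ (barred k) = 1 := fun k => by
    have hmem : ((k : ℕ), (k : ℕ)) ∈ shiftedCells μ :=
      (mk_mem_rowCells (o := id)).2 (by have := hpos k; simp only [id]; omega)
    have hk : (S ⟨_, hmem⟩).index = k := Fin.ext (hS.main_diag ⟨_, hmem⟩ rfl)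
    have hne : unbarred k ≠ barred k := (barred_lt_unbarred k).ne'
    rw [hδ, hδ]
    simp only [show (unbarred k).index = k from rfl, show (barred k).index = k from rfl,
      mem_cellsOf, hmem, exists_true_left]
    rcases letter_eq (S ⟨_, hmem⟩) with h | h
    · rw [hk] at h
      rw [h, if_neg hne.symm, if_pos rfl]
    · rw [hk] at h
      rw [h, if_neg hne, if_pos rfl]
  have hvar : var S + (bar S : ℤ) = ((∑ k : Fin n, ((row S (unbarred k) - con S (unbarred k)) +
      (col S (barred k) - con S (barred k) + count S (barred k))) : ℕ) : ℤ) := by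
    rw [var, bar, Nat.cast_sum, Nat.cast_sum, ← Finset.sum_add_distrib]
    refine Finset.sum_congr rfl fun k _ => ?_
    have := hrow (unbarred k)
    have := hcol (barred k)
    push_cast [*]
    ring
  have hstr : (str S : ℤ) - (n : ℤ) = ((∑ k : Fin n, ((con S (unbarred k) - δ (unbarred k)) +
      (con S (barred k) - δ (barred k))) : ℕ) : ℤ) := by
    have hn : (n : ℤ) = ∑ k : Fin n, ((δ (unbarred k) + δ (barred k) : ℕ) : ℤ) := by
      simp [hδ_add]
    rw [str, sum_letter, hn, Nat.cast_sum, Nat.cast_sum, ← Finset.sum_sub_distrib]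
    refine Finset.sum_congr rfl fun k _ => ?_
    have := hδ_le (unbarred k)
    have := hδ_le (barred k)
    omega
  rw [hvar, hstr, zpow_natCast, zpow_natCast, ← Finset.prod_pow_eq_pow_sum,
    ← Finset.prod_pow_eq_pow_sum, ← Finset.prod_mul_distrib, ← Finset.prod_mul_distrib, prod_letter]
  refine Finset.prod_congr rfl fun k _ => ?_
  simp only [shWeight, ← hδ, card_cellsOf, numRows_cellsOf, numCols_cellsOf, numComponents_cellsOf]
  simp only [show (unbarred k).index = k from rfl, show (barred k).index = k from rfl,
    show (ofLex (unbarred k)).2 = true from rfl, show (ofLex (barred k)).2 = false from rfl,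
    extend_val, if_true, Bool.false_eq_true, if_false, wgt]
  rw [zpow_sub₀ (hx k), zpow_natCast, zpow_natCast, inv_pow, div_eq_mul_inv, pow_add, pow_add]
  ring

theorem isShiftedSymplectic_iff {μ : Fin n → ℕ} {S : Filling n (shiftedCells μ)} :
    IsShiftedSymplectic S ↔ IsValid SameRowOrCol SameDiag DiagEntry S := by
  constructor
  · exact fun h => ⟨fun c d hcd => hcd.elim (fun h' => h.row_weak c d h'.1 h'.2)
      fun h' => h.col_weak c d h'.1 h'.2, fun c d ⟨m, h₀, h₁, h₂⟩ => h.diag_strict c d m h₀ h₁ h₂,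
      h.main_diag⟩
  · exact fun h => ⟨fun c d h₁ h₂ => h.weak c d (Or.inl ⟨h₁, h₂⟩),
      fun c d h₁ h₂ => h.weak c d (Or.inr ⟨h₁, h₂⟩),
      fun c d m h₀ h₁ h₂ => h.strict c d ⟨m, h₀, h₁, h₂⟩, h.entry⟩

theorem sum_shifted_eq_fillSum (hx : ∀ i, x i ≠ 0) (t : K) {μ : Fin n → ℕ} (hμ : StrictAnti μ)
    (hpos : ∀ i, 0 < μ i) :
    ∑ S ∈ shiftedSymplecticTableaux μ, t ^ (var S + (bar S : ℤ)) *
        (1 + t) ^ ((str S : ℤ) - (n : ℤ)) * ∏ k : Fin n, x k ^ wgt S k =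
      fillSum (n := n) SameRowOrCol SameDiag DiagEntry
        (shWeight (extend x) (fun i => (extend x i)⁻¹) t) Finset.univ (shiftedCells μ) := by
  classical
  rw [fillSum, shiftedSymplecticTableaux]
  refine Finset.sum_congr ?_ fun S hS => weight_eq_prod_shWeight hx t hμ hpos
    (isShiftedSymplectic_iff.2 (Finset.mem_filter.1 hS).2.1)
  ext T
  simp only [Finset.mem_filter, Finset.mem_univ, true_and, implies_true, and_true,
    isShiftedSymplectic_iff]

theorem shiftedCells_eq_rowCells (μ : Fin n → ℕ) : shiftedCells μ = rowCells id μ := rfl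

theorem denominator_extend (x : Fin n → K) (t : K) :
    denominator (extend x) (fun i => (extend x i)⁻¹) t n =
      (∏ i : Fin n, (x i + t * (x i)⁻¹)) * (∏ i : Fin n, ∏ j ∈ Finset.Ioi i,
          (x i + t ^ 2 * (x i)⁻¹ + t * x j + t * (x j)⁻¹)) := by
  have hswap : ∏ i : Fin n, ∏ j ∈ Finset.Ioi i,
      (x i + t ^ 2 * (x i)⁻¹ + t * x j + t * (x j)⁻¹) = ∏ j : Fin n, ∏ i ∈ Finset.Iio j,
      (x i + t ^ 2 * (x i)⁻¹ + t * x j + t * (x j)⁻¹) :=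
    Finset.prod_comm' (by simp)
  rw [denominator, Finset.prod_mul_distrib, hswap, Finset.prod_range, Finset.prod_range]
  simp only [extend_val]
  congr 1
  refine Finset.prod_congr rfl fun j _ => ?_
  rw [← Nat.Iio_eq_range, ← Fin.map_valEmbedding_Iio, Finset.prod_map]
  simp only [factor, Fin.valEmbedding_apply, extend_val]

end field

end SpTableaux

theorem mainTheorem6 {K : Type*} [Field K] (n : ℕ) (lam : YoungDiagram)
    (hlam : lam.colLen 0 ≤ n) (x : Fin n → K) (hx : ∀ i, x i ≠ 0) (t : K) :
    (∏ i : Fin n, (x i + t * (x i)⁻¹)) *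
        (∏ i : Fin n, ∏ j ∈ Finset.Ioi i,
          (x i + t ^ 2 * (x i)⁻¹ + t * x j + t * (x j)⁻¹)) *
        SpTableaux.spChar lam x t =
      ∑ S ∈ SpTableaux.shiftedSymplecticTableaux (SpTableaux.addStaircase n lam),
        t ^ (SpTableaux.var S + (SpTableaux.bar S : ℤ)) *
          (1 + t) ^ ((SpTableaux.str S : ℤ) - (n : ℤ)) *
          ∏ k : Fin n, x k ^ SpTableaux.wgt S k := by
  have hμ : StrictAnti (SpTableaux.addStaircase n lam) := by
    intro i j hij
    have := lam.rowLen_anti i j (Fin.le_def.1 hij.le)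
    have := Fin.lt_def.1 hij
    simp only [SpTableaux.addStaircase]
    omega
  have hpos : ∀ i, 0 < SpTableaux.addStaircase n lam i := by
    intro i
    simp only [SpTableaux.addStaircase]
    omega
  have hinv : ∀ i, SpTableaux.extend x i * (SpTableaux.extend x i)⁻¹ = 1 := by
    intro i
    refine mul_inv_cancel₀ ?_
    rw [SpTableaux.extend]
    split_ifs
    · exact hx _
    · exact one_ne_zero
  rw [SpTableaux.sum_shifted_eq_fillSum hx t hμ hpos,
    SpTableaux.shiftedCells_eq_rowCells, SpTableaux.spChar_eq_fillSum hx,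
    SpTableaux.cells_eq_rowCells hlam, ← SpTableaux.lettersBelow_self,
    SpTableaux.fillSum_shifted hinv t le_rfl hμ hpos, SpTableaux.denominator_extend,
    SpTableaux.fillSum_symplectic _ _ t le_rfl fun i j hij => lam.rowLen_anti i j (Fin.le_def.1 hij)]
  rfl
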